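/- Let $D\subset\mathbb R^2$ be open, $\mu,\varepsilon_1>0$, $I_0\in\mathbb R$, and consider the two-degree-of-freedom Hamiltonian $$\mathcal H(x,I,\phi,\varepsilon)=F(x)+G(I)+\varepsilon\,\mathcal H_1(x,I,\phi),$$ real analytic for $x=(x_1,x_2)\in D$, $|I-I_0|<\mu$, and $2\pi$-periodic in $\phi$. Fix $h$, and let $-I=H(x,\phi,\varepsilon)$ be a real analytic, single-valued, $2\pi$-periodic in $\phi$ solution of $\mathcal H(x,I,\phi,\varepsilon)=h$ with $|I-I_0|<\mu$, for $x\in D$, $\phi\in\mathbb R$, $|\varepsilon|<\varepsilon_1$, such that $G'(I)\neq0$ along the solution for $\varepsilon=0$. Write $H=H_0(x)+\varepsilon H_1(x,\phi)+\cdots$ and consider the reduced system $$x_1'=\partial_{x_2}H(x,\phi,\varepsilon),\qquad x_2'=-\partial_{x_1}H(x,\phi,\varepsilon)\qquad\Bigl('=\tfrac{d}{d\phi}\Bigr)$$ in the extended phase space $D\times\mathbb R/2\pi\mathbb Z$. Suppose that for $\varepsilon=0$ it has periodic orbits $q^{\alpha}(\phi)$ in $D$, labelled by their energy $F=\alpha$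 for $\alpha$ near $h_\alpha$, with $\alpha\mapsto q^\alpha(0)$ continuous at $h_\alpha$ and with least periods $\hat T(\alpha)$ satisfying $\hat T(h_\alpha)=2\pi m/n$ for coprime positive integers $m,n$ and $\hat T'(h_\alpha)\neq0$. Let $q=q^{h_\alpha}$ be the resonant orbit. Suppose that all zeros of the subharmonic Mel'nikov function $$M^{m/n}(\bar\phi)=\int_0^{2\pi m}\{H_0,H_1\}(q(\phi-\bar\phi),\phi)\,d\phi$$ (Poisson bracket in $x_1,x_2$) are simple, and that exactly $j$ of them lie in $[0,2\pi m/n)$. Then $j=2km$ for an integer $k\ge0$, and for $\varepsilon\ne0$ small the resonant torus $\{(q(\phi-\bar\phi),\phi)\}$ breaks into exactly $2k=j/m$ distinct $2\pi m$-periodic orbits, with no other $2\pi m$-periodic orbit nearby. That is: the torus has an open neighbourhood $U$ such that for every open neighbourhood $W$ of the torus there is $\varepsilon_0>0$ such that, for $0<|\varepsilon|<\varepsilon_0$, exactly $2k$ orbits of the reduced system that lie in $U$ are $2\pi m$-periodic, all of these lie in $W$, and no orbit in $U$ is $2\pi l$-periodic for an integer $0<l<m$. No saddle point is assumed. -/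

import Mathlib

open Set Filter Topology

noncomputable section

namespace Subharmonic

/-- The Hamiltonian vector field `J ∇K = (∂K/∂x₂, -∂K/∂x₁)` of a function on the plane. -/
def hamVec (K : ℝ × ℝ → ℝ) (x : ℝ × ℝ) : ℝ × ℝ :=
  (fderiv ℝ K x (0, 1), -fderiv ℝ K x (1, 0))

/-- The Poisson bracket `{A, B} = ∂₁A ∂₂B - ∂₂A ∂₁B` with respect to `x₁, x₂`. -/
def poisson (A B : ℝ × ℝ → ℝ) (x : ℝ × ℝ) : ℝ :=
  fderiv ℝ A x (1, 0) * fderiv ℝ B x (0, 1) - fderiv ℝ A x (0, 1) * fderiv ℝ B x (1, 0)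

/-- The two degree of freedom Hamiltonian `F(x) + G(I) + ε K₁(x, I, φ)` is real analytic for
`x ∈ D`, `|I - I₀| < μ`, and is `2π`-periodic in `φ`. -/
structure IsTwoDofHamiltonian (F : ℝ × ℝ → ℝ) (G : ℝ → ℝ) (K₁ : ℝ × ℝ → ℝ → ℝ → ℝ)
    (D : Set (ℝ × ℝ)) (I₀ μ : ℝ) : Prop where
  analytic_F : AnalyticOnNhd ℝ F D
  analytic_G : AnalyticOnNhd ℝ G (Ioo (I₀ - μ) (I₀ + μ))
  analytic_K₁ : AnalyticOnNhd ℝ (fun p : (ℝ × ℝ) × ℝ × ℝ => K₁ p.1 p.2.1 p.2.2)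
    (D ×ˢ Ioo (I₀ - μ) (I₀ + μ) ×ˢ univ)
  periodic_K₁ : ∀ x ∈ D, ∀ I ∈ Ioo (I₀ - μ) (I₀ + μ), Function.Periodic (K₁ x I) (2 * Real.pi)

/-- `-I = H(x, φ, ε)` is the real analytic, single-valued solution for `I`, over `x ∈ D`,
`φ ∈ ℝ / 2πℤ`, `|ε| < ε₁`, of the isoenergy equation `F(x) + G(I) + ε K₁(x, I, φ) = h`.
The frequency `Ω = G'(I)` of the angle `φ` does not vanish along the unperturbed solution. -/
structure IsReducedHamiltonian (F : ℝ × ℝ → ℝ) (G : ℝ → ℝ) (K₁ : ℝ × ℝ → ℝ → ℝ → ℝ)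
    (D : Set (ℝ × ℝ)) (I₀ μ ε₁ h : ℝ) (H : ℝ × ℝ → ℝ → ℝ → ℝ) : Prop where
  analytic : AnalyticOnNhd ℝ (fun p : (ℝ × ℝ) × ℝ × ℝ => H p.1 p.2.1 p.2.2)
    (D ×ˢ univ ×ˢ Ioo (-ε₁) ε₁)
  periodic : ∀ x ∈ D, ∀ ε ∈ Ioo (-ε₁) ε₁, Function.Periodic (fun φ => H x φ ε) (2 * Real.pi)
  action_mem : ∀ x ∈ D, ∀ φ, ∀ ε ∈ Ioo (-ε₁) ε₁, -H x φ ε ∈ Ioo (I₀ - μ) (I₀ + μ)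
  isoenergy : ∀ x ∈ D, ∀ φ, ∀ ε ∈ Ioo (-ε₁) ε₁,
    F x + G (-H x φ ε) + ε * K₁ x (-H x φ ε) φ = h
  frequency_ne_zero : ∀ x ∈ D, ∀ φ, deriv G (-H x φ 0) ≠ 0

/-- `H₀`, from `H = H₀(x) + ε H₁(x, φ) + ⋯` (at `ε = 0` the reduced Hamiltonian does not
depend on `φ`). -/
def H₀ (H : ℝ × ℝ → ℝ → ℝ → ℝ) (x : ℝ × ℝ) : ℝ := H x 0 0

/-- `H₁`, from `H = H₀(x) + ε H₁(x, φ) + ⋯`. -/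
def H₁ (H : ℝ × ℝ → ℝ → ℝ → ℝ) (φ : ℝ) (x : ℝ × ℝ) : ℝ := deriv (fun ε => H x φ ε) 0

/-- `x` is a global solution in `D` of the reduced system `dx/dφ = J ∇H(x, φ, ε)`. -/
def IsSolution (H : ℝ × ℝ → ℝ → ℝ → ℝ) (D : Set (ℝ × ℝ)) (ε : ℝ) (x : ℝ → ℝ × ℝ) : Prop :=
  ∀ φ, x φ ∈ D ∧ HasDerivAt x (hamVec (fun y => H y φ ε) (x φ)) φ

/-- `T` is the least positive period of `x` (in particular `x` is not constant). -/
def IsLeastPeriod (x : ℝ → ℝ × ℝ) (T : ℝ) : Prop :=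
  0 < T ∧ Function.Periodic x T ∧ ∀ S, 0 < S → S < T → ¬ Function.Periodic x S

/-- A family `q a` of periodic orbits of the unperturbed reduced system, labelled by their energy
`F = a` for `a` near `a₀`, with least periods `T a` in the time `φ`, and continuous at `a₀`. -/
def IsPeriodicFamily (H : ℝ × ℝ → ℝ → ℝ → ℝ) (D : Set (ℝ × ℝ)) (F : ℝ × ℝ → ℝ) (a₀ : ℝ)
    (q : ℝ → ℝ → ℝ × ℝ) (T : ℝ → ℝ) : Prop :=
  (∀ᶠ a in 𝓝 a₀, IsSolution H D 0 (q a) ∧ (∀ φ, F (q a φ) = a) ∧ IsLeastPeriod (q a) (T a)) ∧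
    ContinuousAt (fun a => q a 0) a₀

/-- The subharmonic Mel'nikov function of an unperturbed orbit `q`:
`M(φ₀) = ∫_0^{2πm} {H₀, H₁}(q(φ - φ₀), φ) dφ`. -/
def melnikov (H : ℝ × ℝ → ℝ → ℝ → ℝ) (q : ℝ → ℝ × ℝ) (m : ℕ) (φ₀ : ℝ) : ℝ :=
  ∫ φ in (0 : ℝ)..(2 * Real.pi * m), poisson (H₀ H) (H₁ H φ) (q (φ - φ₀))

/-- The extended phase space: the plane times the circle `ℝ / 2πℤ`. -/
abbrev ExtPhase : Type := (ℝ × ℝ) × AddCircle (2 * Real.pi)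

/-- The orbit in the extended phase space traced out by a solution. -/
def extOrbit (x : ℝ → ℝ × ℝ) : Set ExtPhase :=
  range fun φ : ℝ => (x φ, (φ : AddCircle (2 * Real.pi)))

/-- The torus formed by all the points `(q(φ - φ₀), φ)`. -/
def torus (q : ℝ → ℝ × ℝ) : Set ExtPhase :=
  ⋃ φ₀ : ℝ, extOrbit fun φ => q (φ - φ₀)

/-- The orbits in the extended phase space of the solutions in `D` of the reduced system that
satisfy `x(φ + 2πm) = x(φ)`. -/
def periodicOrbits (H : ℝ × ℝ → ℝ → ℝ → ℝ) (D : Set (ℝ × ℝ)) (ε : ℝ) (m : ℕ) :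
    Set (Set ExtPhase) :=
  {O | ∃ x : ℝ → ℝ × ℝ, IsSolution H D ε x ∧ Function.Periodic x (2 * Real.pi * m) ∧
    O = extOrbit x}

end Subharmonic

end

open Set Filter Topology Asymptotics

/-! Near the resonant orbit the reduced Hamiltonian is `K₀ + ε R`, and cutting it off makes its
field bounded and Lipschitz, with a global flow `X`. Along trajectories `K₀ (X t x ε) = K₀ x + ε * G
t x ε`, where `G` integrates the bracket of `K₀` and `R` (`IsModelFlow.energy`). For `ε ≠ 0`, a
point near the resonant orbit therefore returns after time `2πm` exactly when two scalar functions
vanish: the projection of its displacement on `hamVec K₀`, and `G`. Together they form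
`bifurcationMap`. Using `G` instead of the energy change `ε * G` removes the degeneracy at `ε = 0`,
where every point of the resonant orbit returns.

At `ε = 0`, along the resonant orbit, the first function is identically zero and the second is the
Mel'nikov function (`melnikov_eq`). Hence the derivative along the orbit is zero for the first and,
at a simple zero, nonzero for the second. The full derivative of the first function is nonzero
because the period varies with the energy (`twist_deriv_ne_zero`). So each simple zero is
nondegenerate (`bifurcationMap_injective`), and the implicit function theorem gives exactly one
branch of returning points through it. Other points of the orbit have no returning points near them,
and compactness of the orbit makes these statements uniform. The family of orbits is only known to
be continuous, and its period differentiable, at the resonant label; the twist is therefore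
extracted from closest points on neighbouring orbits, without action-angle coordinates.

For the count, the Mel'nikov function has the periods `2π` and `2πm/n`, hence `2π/n`. Its zeros in
`[0, 2πm/n)` are `m` translates of those in one period, and over a period simple zeros are even in
number because each one changes the sign; so `j = 2km`. The `j` returning points are permuted by the
time-`2π` map. No cycle is shorter than `m`, since `2πl` with `0 < l < m` is not a multiple of
`2πm/n`. They therefore form `j / m` orbits (`encard_orbits_mul`). -/

namespace Subharmonic

/-! ### Global flows of bounded Lipschitz fields and their differentiability in the initial point.
-/

section Flow

variable {E : Type*} [NormedAddCommGroup E] [NormedSpace ℝ E] {X : E → E} {Φ : ℝ → E → E}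
  {K : NNReal}

/-- `Φ` is the global flow of the vector field `X`. -/
def IsFlow (X : E → E) (Φ : ℝ → E → E) : Prop :=
  ∀ x, Φ 0 x = x ∧ ∀ t, HasDerivAt (fun s => Φ s x) (X (Φ t x)) t

theorem eq_of_hasDerivAt_of_lipschitz {v : ℝ → E → E} (hv : ∀ t, LipschitzWith K (v t))
    {f g : ℝ → E} (hf : ∀ t, HasDerivAt f (v t (f t)) t) (hg : ∀ t, HasDerivAt g (v t (g t)) t)
    (t₀ : ℝ) (h : f t₀ = g t₀) : f = g :=
  ODE_solution_unique_univ (s := fun _ => univ) (fun t => (hv t).lipschitzOnWith)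
    (fun t => ⟨hf t, mem_univ _⟩) (fun t => ⟨hg t, mem_univ _⟩) h

/-- A field bounded by `B` cannot leave the ball of radius `B * T` within time `T`, so
Picard–Lindelöf applies on every interval; uniqueness glues the solutions. -/
theorem exists_isFlow [CompleteSpace E] (hX : LipschitzWith K X) {B : ℝ} (hB : ∀ x, ‖X x‖ ≤ B) :
    ∃ Φ : ℝ → E → E, IsFlow X Φ := by
  have key : ∀ (x : E) (T : ℝ), 0 < T → ∃ α : ℝ → E, α 0 = x ∧
      ∀ t ∈ Ioo (-T) T, HasDerivAt α (X (α t)) t := by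
    intro x T hT
    have hB0 : 0 ≤ B := (norm_nonneg _).trans (hB x)
    have hp : IsPicardLindelof (fun _ => X) (tmin := -T) (tmax := T)
        ⟨0, by constructor <;> linarith⟩ x (⟨B, hB0⟩ * ⟨T, hT.le⟩) 0 ⟨B, hB0⟩ K :=
      IsPicardLindelof.of_time_independent (fun y _ => hB y) hX.lipschitzOnWith (by
        simp only [sub_zero, zero_sub, neg_neg, max_self, NNReal.coe_zero]
        exact le_of_eq rfl)
    obtain ⟨α, h0, h1⟩ := hp.exists_eq_forall_mem_Icc_hasDerivWithinAt₀
    exact ⟨α, h0, fun t ht => (h1 t (Ioo_subset_Icc_self ht)).hasDerivAt (Icc_mem_nhds ht.1 ht.2)⟩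
  choose! α h0 h1 using key
  have heq : ∀ (x : E) (S T : ℝ), 0 < S → S ≤ T → EqOn (α x S) (α x T) (Ioo (-S) S) := by
    intro x S T hS hST
    have hT : 0 < T := hS.trans_le hST
    refine ODE_solution_unique_of_mem_Ioo (v := fun _ => X) (s := fun _ => univ) (t₀ := 0)
      (fun t _ => hX.lipschitzOnWith) (by constructor <;> linarith)
      (fun t ht => ⟨h1 x S hS t ht, mem_univ _⟩)
      (fun t ht => ⟨h1 x T hT t ⟨by linarith [ht.1], by linarith [ht.2]⟩, mem_univ _⟩) ?_
    rw [h0 x S hS, h0 x T hT]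
  -- Reading time `t` off the solution on the larger interval of radius `|t| + 1` keeps `t`
  -- interior, as two-sided derivatives require.
  refine ⟨fun t x => α x (|t| + 1) t, fun x => ⟨h0 x _ (by positivity), fun t => ?_⟩⟩
  have habs : t ∈ Ioo (-(|t| + 1)) (|t| + 1) := abs_lt.1 (lt_add_one _)
  refine (h1 x (|t| + 1) (by positivity) t habs).congr_of_eventuallyEq ?_
  filter_upwards [Ioo_mem_nhds habs.1 habs.2] with s hs
  rcases le_total (|s| + 1) (|t| + 1) with h | h
  · exact heq x _ _ (by positivity) h (abs_lt.1 (lt_add_one _))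
  · exact (heq x _ _ (by positivity) h hs).symm

namespace IsFlow

theorem add (h : IsFlow X Φ) (hX : LipschitzWith K X) (s t : ℝ) (x : E) :
    Φ (s + t) x = Φ s (Φ t x) := by
  have := eq_of_hasDerivAt_of_lipschitz (v := fun _ => X) (fun _ => hX)
    (f := fun s => Φ (s + t) x) (g := fun s => Φ s (Φ t x))
    (fun s => ((h x).2 (s + t)).comp_add_const s t) (fun s => (h (Φ t x)).2 s) 0
    (by simp [(h (Φ t x)).1])
  exact congrFun this s

theorem neg (h : IsFlow X Φ) : IsFlow (fun x => -X x) (fun t x => Φ (-t) x) := fun x =>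
  ⟨by simp [(h x).1], fun t => by
    simpa [Function.comp_def] using ((h x).2 (-t)).scomp t (hasDerivAt_neg t)⟩

theorem dist_le_of_nonneg (h : IsFlow X Φ) (hX : LipschitzWith K X) {t : ℝ} (ht : 0 ≤ t) (x y : E) :
    dist (Φ t x) (Φ t y) ≤ dist x y * Real.exp (K * t) := by
  have := dist_le_of_trajectories_ODE (v := fun _ => X) (fun _ => hX)
    (f := fun s => Φ s x) (g := fun s => Φ s y) (a := 0) (b := t) (δ := dist x y)
    (HasDerivAt.continuousOn fun s _ => (h x).2 s)
    (fun s _ => ((h x).2 s).hasDerivWithinAt)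
    (HasDerivAt.continuousOn fun s _ => (h y).2 s)
    (fun s _ => ((h y).2 s).hasDerivWithinAt) (by rw [(h x).1, (h y).1]) t ⟨ht, le_rfl⟩
  simpa using this

theorem dist_le (h : IsFlow X Φ) (hX : LipschitzWith K X) (t : ℝ) (x y : E) :
    dist (Φ t x) (Φ t y) ≤ dist x y * Real.exp (K * |t|) := by
  rcases le_total 0 t with ht | ht
  · rw [abs_of_nonneg ht]
    exact h.dist_le_of_nonneg hX ht x y
  · rw [abs_of_nonpos ht]
    simpa using h.neg.dist_le_of_nonneg hX.neg (neg_nonneg.2 ht) x y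

theorem continuous (h : IsFlow X Φ) (hX : LipschitzWith K X) :
    Continuous fun p : ℝ × E => Φ p.1 p.2 := by
  rw [continuous_iff_continuousAt]
  rintro ⟨t₀, x₀⟩
  rw [ContinuousAt, tendsto_iff_dist_tendsto_zero]
  have hc : Continuous fun t => Φ t x₀ := continuous_iff_continuousAt.2
    fun t => ((h x₀).2 t).continuousAt
  have hlim : Tendsto (fun p : ℝ × E => dist p.2 x₀ * Real.exp (K * |p.1|) +
      dist (Φ p.1 x₀) (Φ t₀ x₀)) (𝓝 (t₀, x₀)) (𝓝 0) := by
    have : Continuous fun p : ℝ × E => dist p.2 x₀ * Real.exp (K * |p.1|) +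
      dist (Φ p.1 x₀) (Φ t₀ x₀) := by fun_prop
    simpa using this.tendsto (t₀, x₀)
  refine squeeze_zero (fun _ => dist_nonneg) (fun p => ?_) hlim
  exact (dist_triangle _ (Φ p.1 x₀) _).trans (by gcongr; exact h.dist_le hX _ _ _)

/-- The derivative solves the linearized equation along the trajectory. Grönwall compares it with
the difference of two arbitrary nearby trajectories, which gives strict differentiability directly.
The bound on `K * τ` lets one Picard–Lindelöf step suffice: in the unit ball about the identity the
speed is at most `2 * K`. -/
theorem exists_hasStrictFDerivAt_of_small [CompleteSpace E] (h : IsFlow X Φ)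
    (hX : LipschitzWith K X)
    (hX1 : ContDiff ℝ 1 X) {τ : ℝ} (hτ : 0 ≤ τ) (hKτ : K * τ ≤ 1 / 2) (x : E) :
    ∃ Φ' : E →L[ℝ] E, HasStrictFDerivAt (Φ τ) Φ' x := by
  have hu : Continuous fun t => Φ t x := continuous_iff_continuousAt.2
    fun t => ((h x).2 t).continuousAt
  have hDX : Continuous (fderiv ℝ X) := hX1.continuous_fderiv one_ne_zero
  set A : ℝ → E →L[ℝ] E := fun t => fderiv ℝ X (Φ t x) with hA
  have hAc : Continuous A := hDX.comp hu
  have hAK : ∀ t, ‖A t‖ ≤ K := fun t => norm_fderiv_le_of_lipschitz ℝ hX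
  -- the fundamental solution of the linearized equation
  have hp : IsPicardLindelof (fun t (Y : E →L[ℝ] E) => (A t).comp Y) (tmin := 0) (tmax := τ)
      ⟨0, le_rfl, hτ⟩ (ContinuousLinearMap.id ℝ E) 1 0 (2 * K) K := by
    refine ⟨fun t _ => ?_, fun Y _ => ?_, fun t _ Y hY => ?_, ?_⟩
    · refine LipschitzWith.lipschitzOnWith (LipschitzWith.of_dist_le_mul fun Y Z => ?_)
      rw [dist_eq_norm, dist_eq_norm, ← ContinuousLinearMap.comp_sub]
      exact (ContinuousLinearMap.opNorm_comp_le _ _).trans (by gcongr; exact hAK t)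
    · exact (hAc.clm_comp continuous_const).continuousOn
    · have h1 : ‖Y‖ ≤ 2 := by
        have := norm_le_of_mem_closedBall hY
        have h2 : ‖ContinuousLinearMap.id ℝ E‖ ≤ 1 := ContinuousLinearMap.norm_id_le
        norm_num at this
        linarith
      calc ‖(A t).comp Y‖ ≤ ‖A t‖ * ‖Y‖ := ContinuousLinearMap.opNorm_comp_le _ _
        _ ≤ K * 2 := by gcongr; exact hAK t
        _ = _ := by push_cast; ring
    · simp only [sub_zero, sub_self, max_eq_left hτ]
      push_cast
      linarith
  obtain ⟨Y, hY0, hY⟩ := hp.exists_eq_forall_mem_Icc_hasDerivWithinAt₀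
  refine ⟨Y τ, .of_isLittleO ?_⟩
  rw [Asymptotics.isLittleO_iff]
  intro c hc
  set M := Real.exp (K * τ) with hM
  have hM0 : 0 < M := Real.exp_pos _
  have hMt : ∀ t ∈ Icc 0 τ, Real.exp (K * t) ≤ M := fun t ht =>
    Real.exp_le_exp.2 (by gcongr; exact ht.2)
  have hlin : ∀ e : ℝ, gronwallBound 0 K e τ = e * gronwallBound 0 K 1 τ := by
    intro e
    unfold gronwallBound
    split_ifs <;> ring
  have hG0 : 0 ≤ gronwallBound 0 K 1 τ := by
    unfold gronwallBound
    split_ifs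
    · simpa using hτ
    · have : 1 ≤ Real.exp (K * τ) := Real.one_le_exp (by positivity)
      have : 0 ≤ Real.exp (K * τ) - 1 := by linarith
      simp only [zero_mul, zero_add]
      positivity
  set G := gronwallBound 0 K 1 τ with hG
  set η := c / (M * (G + 1)) with hη
  have hη0 : 0 < η := by positivity
  -- uniform closeness of the derivative along the trajectory
  have hunif := (isCompact_Icc (a := (0 : ℝ)) (b := τ)).image hu |>.uniformContinuousAt_of_continuousAt
    (fderiv ℝ X) (fun a _ => hDX.continuousAt) (Metric.dist_mem_uniformity hη0)
  obtain ⟨r, hr0, hr⟩ := Metric.mem_uniformity_dist.1 hunif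
  have hstrict : ∀ t ∈ Icc 0 τ, ∀ p ∈ Metric.ball (Φ t x) r, ∀ q ∈ Metric.ball (Φ t x) r,
      ‖X p - X q - A t (p - q)‖ ≤ η * ‖p - q‖ := by
    intro t ht p hp q hq
    refine Convex.norm_image_sub_le_of_norm_fderiv_le' (𝕜 := ℝ)
      (fun z _ => (hX1.differentiable one_ne_zero) z) (fun z hz => ?_) (convex_ball _ _) hq hp
    have := @hr (Φ t x) z (by rw [dist_comm]; exact hz) (mem_image_of_mem _ ht)
    simp only [mem_ofPred_eq] at this
    rw [dist_comm, dist_eq_norm] at this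
    exact this.le
  have hball : Metric.ball x (r / M) ∈ 𝓝 x := Metric.ball_mem_nhds _ (by positivity)
  filter_upwards [prod_mem_nhds hball hball] with ⟨a, b⟩ ⟨ha, hb⟩
  have hnear : ∀ a ∈ Metric.ball x (r / M), ∀ t ∈ Icc 0 τ, Φ t a ∈ Metric.ball (Φ t x) r := by
    intro a ha t ht
    rw [Metric.mem_ball] at ha ⊢
    calc dist (Φ t a) (Φ t x) ≤ dist a x * Real.exp (K * t) := h.dist_le_of_nonneg hX ht.1 _ _
      _ ≤ dist a x * M := by gcongr; exact hMt t ht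
      _ < r := by rwa [lt_div_iff₀ hM0] at ha
  have hgr := dist_le_of_approx_trajectories_ODE_of_mem (v := fun t z => A t z)
    (s := fun _ => univ) (K := K) (a := 0) (b := τ) (δ := 0) (εf := η * (M * ‖a - b‖)) (εg := 0)
    (f := fun t => Φ t a - Φ t b) (f' := fun t => X (Φ t a) - X (Φ t b))
    (g := fun t => Y t (a - b)) (g' := fun t => A t (Y t (a - b)))
    (fun t _ => ((A t).lipschitz.weaken (by exact_mod_cast hAK t)).lipschitzOnWith)
    (HasDerivAt.continuousOn fun t _ => ((h a).2 t).sub ((h b).2 t))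
    (fun t _ => (((h a).2 t).sub ((h b).2 t)).hasDerivWithinAt)
    (fun t ht => by
      have ht' := Ico_subset_Icc_self ht
      rw [dist_eq_norm]
      refine (hstrict t ht' _ (hnear a ha t ht') _ (hnear b hb t ht')).trans ?_
      gcongr
      rw [← dist_eq_norm, ← dist_eq_norm, mul_comm]
      exact (h.dist_le_of_nonneg hX ht'.1 _ _).trans (by gcongr; exact hMt t ht'))
    (fun _ _ => mem_univ _)
    (ContinuousOn.clm_apply (fun t ht => (hY t ht).continuousWithinAt) continuousOn_const)
    (fun t ht => by
      have h1 : HasDerivWithinAt Y ((A t).comp (Y t)) (Ici t) t :=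
        (hY t (Ico_subset_Icc_self ht)).mono_of_mem_nhdsWithin
        (Icc_mem_nhdsGE_of_mem ht)
      simpa using h1.clm_apply (hasDerivWithinAt_const t (Ici t) (a - b)))
    (fun t _ => by simp) (fun _ _ => mem_univ _)
    (by simp [(h a).1, (h b).1, hY0]) τ ⟨hτ, le_rfl⟩
  rw [dist_eq_norm, sub_zero, add_zero, hlin] at hgr
  refine hgr.trans ?_
  calc η * (M * ‖a - b‖) * G ≤ η * (M * ‖a - b‖) * (G + 1) := by gcongr; linarith
    _ = c * ‖a - b‖ := by rw [hη]; field_simp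

theorem exists_hasStrictFDerivAt [CompleteSpace E] (h : IsFlow X Φ) (hX : LipschitzWith K X)
    (hX1 : ContDiff ℝ 1 X) {t : ℝ} (ht : 0 ≤ t) (x : E) :
    ∃ Φ' : E →L[ℝ] E, HasStrictFDerivAt (Φ t) Φ' x := by
  -- The time is cut into `N` steps short enough for the local result; the chain rule composes them.
  obtain ⟨N, hN⟩ := exists_nat_gt (2 * (K * t))
  have hN0 : (0 : ℝ) < N := lt_of_le_of_lt (by positivity) hN
  have hsmall : K * (t / N) ≤ 1 / 2 := by
    rw [← mul_div_assoc, div_le_iff₀ hN0]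
    linarith
  have hiter : ∀ (k : ℕ) (x : E), ∃ Φ' : E →L[ℝ] E, HasStrictFDerivAt (Φ (k * (t / N))) Φ' x := by
    intro k
    induction k with
    | zero =>
      intro x
      refine ⟨.id ℝ E, ?_⟩
      have : Φ ((0 : ℕ) * (t / N)) = id := by
        ext y
        simp [(h y).1]
      rw [this]
      exact hasStrictFDerivAt_id x
    | succ k ih =>
      intro x
      obtain ⟨A, hA⟩ := ih x
      obtain ⟨B, hB⟩ := h.exists_hasStrictFDerivAt_of_small hX hX1 (by positivity) hsmall
        (Φ (k * (t / N)) x)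
      refine ⟨B.comp A, ?_⟩
      have : Φ ((k + 1 : ℕ) * (t / N)) = Φ (t / N) ∘ Φ (k * (t / N)) := by
        ext y
        simp only [Function.comp]
        rw [← h.add hX]
        congr 1
        push_cast
        ring
      rw [this]
      exact hB.comp x hA
  have := hiter N x
  rwa [mul_div_cancel₀ _ hN0.ne'] at this

end IsFlow

end Flow

/-! ### Smoothness of parametric integrals and Hadamard's lemma. -/

section ParametricIntegral

theorem hasFDerivAt_integral_of_contDiff {E F : Type*} [NormedAddCommGroup E] [NormedSpace ℝ E]
    [NormedAddCommGroup F] [NormedSpace ℝ F] {f : E × ℝ → F}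
    (hf : ContDiff ℝ 1 f) (x₀ : E) :
    HasFDerivAt (fun x => ∫ s in (0 : ℝ)..1, f (x, s))
      (∫ s in (0 : ℝ)..1, (fderiv ℝ f (x₀, s)).comp (.inl ℝ E ℝ)) x₀ := by
  have hD : Continuous fun p : E × ℝ => (fderiv ℝ f p).comp (.inl ℝ E ℝ) :=
    (hf.continuous_fderiv one_ne_zero).clm_comp continuous_const
  obtain ⟨B, hB⟩ : ∃ B, ∀ s ∈ Icc (0 : ℝ) 1, ‖(fderiv ℝ f (x₀, s)).comp (.inl ℝ E ℝ)‖ ≤ B := by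
    refine (isCompact_Icc (a := (0 : ℝ)) (b := 1)).exists_bound_of_continuousOn ?_
    exact (hD.comp (Continuous.prodMk_right x₀)).continuousOn
  have hs : ∀ᶠ x in 𝓝 x₀, ∀ s ∈ Icc (0 : ℝ) 1,
      ‖(fderiv ℝ f (x, s)).comp (.inl ℝ E ℝ)‖ < B + 1 := by
    refine isCompact_Icc.eventually_forall_of_forall_eventually fun s hs => ?_
    refine hD.norm.continuousAt.eventually_lt (x₀ := (x₀, s)) continuousAt_const ?_
    exact (hB s hs).trans_lt (lt_add_one B)
  refine intervalIntegral.hasFDerivAt_integral_of_dominated_of_fderiv_le (𝕜 := ℝ)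
    (bound := fun _ => B + 1) (F' := fun x s => (fderiv ℝ f (x, s)).comp (.inl ℝ E ℝ)) hs
    (.of_forall fun x => ?_) ?_ ?_ (.of_forall fun s hs x hx => ?_) ?_
    (.of_forall fun s _ x _ => ?_)
  · exact (hf.continuous.comp (Continuous.prodMk_right x)).aestronglyMeasurable
  · exact (hf.continuous.comp (Continuous.prodMk_right x₀)).intervalIntegrable _ _
  · exact (hD.comp (Continuous.prodMk_right x₀)).aestronglyMeasurable
  · rw [uIoc_of_le zero_le_one] at hs
    exact (hx s (Ioc_subset_Icc_self hs)).le
  · exact intervalIntegrable_const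
  · exact ((hf.differentiable one_ne_zero) (x, s)).hasFDerivAt.comp x (hasFDerivAt_prodMk_left x s)

theorem contDiff_nat_integral {E : Type} [NormedAddCommGroup E] [NormedSpace ℝ E] (n : ℕ) :
    ∀ {F : Type} [NormedAddCommGroup F] [NormedSpace ℝ F] {f : E × ℝ → F},
      ContDiff ℝ n f → ContDiff ℝ n fun x => ∫ s in (0 : ℝ)..1, f (x, s) := by
  induction n with
  | zero =>
    intro F _ _ f hf
    simp only [Nat.cast_zero, contDiff_zero] at hf ⊢
    exact intervalIntegral.continuous_parametric_intervalIntegral_of_continuous'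
      (f := fun x s => f (x, s)) hf 0 1
  | succ n ih =>
    intro F _ _ f hf
    push_cast at hf ⊢
    refine contDiff_succ_iff_hasFDerivAt.2
      ⟨_, ih (f := fun p => (fderiv ℝ f p).comp (.inl ℝ E ℝ)) ?_,
        fun x => hasFDerivAt_integral_of_contDiff (hf.of_le (by simp)) x⟩
    exact (hf.fderiv_right le_rfl).clm_comp contDiff_const

theorem contDiff_integral {E F : Type} [NormedAddCommGroup E] [NormedSpace ℝ E]
    [NormedAddCommGroup F] [NormedSpace ℝ F] {f : E × ℝ → F} (hf : ContDiff ℝ (⊤ : ℕ∞) f) :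
    ContDiff ℝ (⊤ : ℕ∞) fun x => ∫ s in (0 : ℝ)..1, f (x, s) :=
  contDiff_infty.2 fun n => contDiff_nat_integral n (contDiff_infty.1 hf n)

/-- Hadamard's lemma for the dependence on the last variable. -/
theorem hadamard {f : (ℝ × ℝ) × ℝ × ℝ → ℝ} (hf : ContDiff ℝ (⊤ : ℕ∞) f)
    (x : ℝ × ℝ) (φ ε : ℝ) :
    f (x, φ, ε) = f (x, φ, 0) +
      ε * ∫ s in (0 : ℝ)..1, fderiv ℝ f (x, φ, s * ε) (0, 0, 1) := by
  have hD : Continuous fun s : ℝ => fderiv ℝ f (x, φ, s * ε) (0, 0, 1) :=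
    ((hf.continuous_fderiv (by simp)).comp (by fun_prop)).clm_apply continuous_const
  have h : ∀ s : ℝ, HasDerivAt (fun s : ℝ => f (x, φ, s * ε))
      (ε * fderiv ℝ f (x, φ, s * ε) (0, 0, 1)) s := by
    intro s
    have h1 : HasDerivAt (fun s : ℝ => (x, φ, s * ε)) ((0 : ℝ × ℝ), (0 : ℝ), ε) s := by
      refine (hasDerivAt_const s x).prodMk ((hasDerivAt_const s φ).prodMk ?_)
      simpa using (hasDerivAt_id s).mul_const ε
    have h2 := ((hf.differentiable (by simp)) (x, φ, s * ε)).hasFDerivAt.comp_hasDerivAt s h1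
    have h3 : ((0 : ℝ × ℝ), (0 : ℝ), ε) = ε • ((0 : ℝ × ℝ), (0 : ℝ), (1 : ℝ)) := by simp
    rw [h3, map_smul, smul_eq_mul] at h2
    exact h2
  have := intervalIntegral.integral_eq_sub_of_hasDerivAt (a := 0) (b := 1) (fun s _ => h s)
    ((hD.const_mul ε).intervalIntegrable _ _)
  rw [intervalIntegral.integral_const_mul] at this
  simp only [one_mul, zero_mul] at this
  linarith

end ParametricIntegral

/-! ### Global bounds from compact support and periodicity. -/

section Bounds

variable {G : Type*} [NormedAddCommGroup G] {f : (ℝ × ℝ) × ℝ × ℝ → G}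
  {K : Set (ℝ × ℝ)} {c : ℝ}

/-- The support is bounded only in `x` and `ε`; periodicity confines `φ` to `[0, 2π]`, which leaves
a compact set. -/
theorem exists_bound_of_periodic (hf : Continuous f) (hK : IsCompact K)
    (hper : ∀ x φ ε, f (x, φ + 2 * Real.pi, ε) = f (x, φ, ε))
    (h0 : ∀ x φ ε, x ∉ K ∨ ε ∉ Icc (-c) c → f (x, φ, ε) = 0) : ∃ B, ∀ p, ‖f p‖ ≤ B := by
  obtain ⟨B, hB⟩ := (hK.prod ((isCompact_Icc (a := (0 : ℝ)) (b := 2 * Real.pi)).prod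
    (isCompact_Icc (a := -c) (b := c)))).exists_bound_of_continuousOn hf.continuousOn
  refine ⟨max B 0, ?_⟩
  rintro ⟨x, φ, ε⟩
  by_cases h : x ∉ K ∨ ε ∉ Icc (-c) c
  · simp [h0 x φ ε h]
  · push Not at h
    have hp : Function.Periodic (fun φ => f (x, φ, ε)) (2 * Real.pi) := fun φ => hper x φ ε
    obtain ⟨ψ, hψ, hψ'⟩ := hp.exists_mem_Ico₀ Real.two_pi_pos φ
    rw [hψ']
    exact (hB _ ⟨h.1, Ico_subset_Icc_self hψ, h.2⟩).trans (le_max_left _ _)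

theorem eventually_fst_notMem (hK : IsCompact K) {x : ℝ × ℝ} (hx : x ∉ K) {φ ε : ℝ} :
    ∀ᶠ p : (ℝ × ℝ) × ℝ × ℝ in 𝓝 (x, φ, ε), p.1 ∉ K :=
  (hK.isClosed.isOpen_compl.preimage continuous_fst).mem_nhds hx

theorem exists_lipschitz_of_periodic [NormedSpace ℝ G] (hf : ContDiff ℝ 1 f) (hK : IsCompact K)
    (hper : ∀ x φ ε, f (x, φ + 2 * Real.pi, ε) = f (x, φ, ε))
    (h0 : ∀ x φ ε, x ∉ K ∨ ε ∉ Icc (-c) c → f (x, φ, ε) = 0) : ∃ L : NNReal, LipschitzWith L f := by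
  have hper' : ∀ x φ ε, fderiv ℝ f (x, φ + 2 * Real.pi, ε) = fderiv ℝ f (x, φ, ε) := by
    intro x φ ε
    have h1 : (fun p : (ℝ × ℝ) × ℝ × ℝ => f (p + (0, 2 * Real.pi, 0))) = f := by
      ext ⟨x, φ, ε⟩
      simpa using hper x φ ε
    have h2 := fderiv_comp_add_right (𝕜 := ℝ) (f := f) (x := (x, φ, ε)) (0, 2 * Real.pi, 0)
    rw [h1] at h2
    simpa using h2.symm
  have h0' : ∀ x φ ε, x ∉ K ∨ ε ∉ Icc (-c) c → fderiv ℝ f (x, φ, ε) = 0 := by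
    intro x φ ε h
    have : f =ᶠ[𝓝 (x, φ, ε)] fun _ => 0 := by
      rcases h with h | h
      · filter_upwards [eventually_fst_notMem hK h] with p hp using h0 _ _ _ (Or.inl hp)
      · have : ∀ᶠ p : (ℝ × ℝ) × ℝ × ℝ in 𝓝 (x, φ, ε), p.2.2 ∉ Icc (-c) c :=
          (isClosed_Icc.isOpen_compl.preimage continuous_snd.snd).mem_nhds h
        filter_upwards [this] with p hp using h0 _ _ _ (Or.inr hp)
    rw [this.fderiv_eq]
    simp
  obtain ⟨B, hB⟩ := exists_bound_of_periodic (hf.continuous_fderiv one_ne_zero) hK hper' h0'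
  have hB0 : 0 ≤ B := (norm_nonneg _).trans (hB 0)
  exact ⟨⟨B, hB0⟩, lipschitzWith_of_nnnorm_fderiv_le (𝕜 := ℝ) (hf.differentiable one_ne_zero) hB⟩

end Bounds

/-! ### Smooth cutoff functions in space and in the parameter. -/

section Cutoff

theorem exists_cutoff {C D : Set (ℝ × ℝ)} (hC : IsCompact C) (hD : IsOpen D) (hCD : C ⊆ D) :
    ∃ (χ : ℝ × ℝ → ℝ) (K N : Set (ℝ × ℝ)), ContDiff ℝ (⊤ : ℕ∞) χ ∧ IsCompact K ∧ K ⊆ D ∧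
      IsOpen N ∧ C ⊆ N ∧ N ⊆ D ∧ (∀ x ∉ K, χ x = 0) ∧ ∀ x ∈ N, χ x = 1 := by
  obtain ⟨K, hK, hCK, hKD⟩ := exists_compact_between hC hD hCD
  obtain ⟨χ, h1, h2, -⟩ := exists_contMDiffMap_one_nhds_of_subset_interior
    (modelWithCornersSelf ℝ (ℝ × ℝ)) (n := ⊤) hC.isClosed hCK
  obtain ⟨N, hN, hCN, hN1⟩ := eventually_nhdsSet_iff_exists.1 h1
  refine ⟨χ, K, N, contMDiff_iff_contDiff.1 χ.contMDiff, hK, hKD, hN, hCN, ?_, h2, hN1⟩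
  intro x hx
  by_contra hxD
  have := h2 x (fun h => hxD (hKD h))
  rw [hN1 x hx] at this
  exact one_ne_zero this

theorem exists_cutoff_real {c : ℝ} (hc : 0 < c) :
    ∃ ψ : ℝ → ℝ, ContDiff ℝ (⊤ : ℕ∞) ψ ∧ (∀ ε, c / 2 ≤ |ε| → ψ ε = 0) ∧
      ∀ ε, |ε| ≤ c / 4 → ψ ε = 1 := by
  let f : ContDiffBump (0 : ℝ) := ⟨c / 4, c / 2, by linarith, by linarith⟩
  refine ⟨f, f.contDiff, fun ε h => f.zero_of_le_dist ?_, fun ε h => f.one_of_mem_closedBall ?_⟩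
  · simpa [Real.dist_eq] using h
  · simpa [Real.dist_eq] using h

end Cutoff

/-! ### Global smooth model of the reduced Hamiltonian. -/

section ReducedHamiltonian

variable {F : ℝ × ℝ → ℝ} {G : ℝ → ℝ} {K₁ : ℝ × ℝ → ℝ → ℝ → ℝ} {D : Set (ℝ × ℝ)}
  {I₀ μ ε₁ h : ℝ} {H : ℝ × ℝ → ℝ → ℝ → ℝ}

/-- Differentiating the isoenergy relation in `φ` at `ε = 0` gives `G' * ∂H/∂φ = 0`, and the
frequency `G'` is not zero. -/
theorem IsReducedHamiltonian.eq_unperturbed (hε₁ : 0 < ε₁)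
    (hK : IsTwoDofHamiltonian F G K₁ D I₀ μ) (hH : IsReducedHamiltonian F G K₁ D I₀ μ ε₁ h H)
    {x : ℝ × ℝ} (hx : x ∈ D) (φ : ℝ) : H x φ 0 = H₀ H x := by
  have h0 : (0 : ℝ) ∈ Ioo (-ε₁) ε₁ := by constructor <;> linarith
  have hd : Differentiable ℝ fun φ => H x φ 0 := by
    intro φ
    have h1 := (hH.analytic (x, φ, 0) ⟨hx, mem_univ _, h0⟩).differentiableAt
    exact h1.comp φ (f := fun φ : ℝ => (x, φ, (0 : ℝ))) (by fun_prop)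
  refine is_const_of_deriv_eq_zero hd (fun φ => ?_) φ 0
  have h1 := (hd φ).hasDerivAt
  have h2 := (hK.analytic_G _ (hH.action_mem x hx φ 0 h0)).differentiableAt.hasDerivAt
  have h3 := h2.comp φ h1.neg
  have h4 : (G ∘ fun φ => -H x φ 0) = fun _ => h - F x := by
    ext φ
    have := hH.isoenergy x hx φ 0 h0
    simp only [zero_mul, add_zero] at this
    simp only [Function.comp]
    linarith
  have h5 := h3.unique (by
    show HasDerivAt (G ∘ fun φ => -H x φ 0) 0 φ
    rw [h4]
    exact hasDerivAt_const _ _)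
  have := hH.frequency_ne_zero x hx φ
  simpa [this] using h5

/-- Near a compact subset of `D` and for small `ε`, the reduced Hamiltonian is
`K₀(x) + ε R(x, φ, ε)` with globally defined smooth `K₀`, `R`, periodic in `φ` and vanishing for
`x` or `ε` outside a compact set. -/
theorem IsReducedHamiltonian.exists_global_model (hD : IsOpen D) (hε₁ : 0 < ε₁)
    (hK : IsTwoDofHamiltonian F G K₁ D I₀ μ) (hH : IsReducedHamiltonian F G K₁ D I₀ μ ε₁ h H)
    {C : Set (ℝ × ℝ)} (hC : IsCompact C) (hCD : C ⊆ D) :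
    ∃ (K₀ : ℝ × ℝ → ℝ) (R : (ℝ × ℝ) × ℝ × ℝ → ℝ) (K N : Set (ℝ × ℝ)) (c δ : ℝ),
      ContDiff ℝ (⊤ : ℕ∞) K₀ ∧ ContDiff ℝ (⊤ : ℕ∞) R ∧ IsCompact K ∧ IsOpen N ∧ C ⊆ N ∧ N ⊆ D ∧
      0 < δ ∧ (∀ x ∉ K, K₀ x = 0) ∧
      (∀ x φ ε, x ∉ K ∨ ε ∉ Icc (-c) c → R (x, φ, ε) = 0) ∧
      (∀ x φ ε, R (x, φ + 2 * Real.pi, ε) = R (x, φ, ε)) ∧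
      ∀ x ∈ N, ∀ φ ε, |ε| < δ → H x φ ε = K₀ x + ε * R (x, φ, ε) := by
  obtain ⟨χ, K, N, hχ, hKc, hKD, hN, hCN, hND, hχ0, hχ1⟩ := exists_cutoff hC hD hCD
  obtain ⟨ψ, hψ, hψ0, hψ1⟩ := exists_cutoff_real hε₁
  have h0 : (0 : ℝ) ∈ Ioo (-ε₁) ε₁ := by constructor <;> linarith
  set f : (ℝ × ℝ) × ℝ × ℝ → ℝ := fun p => χ p.1 * ψ p.2.2 * H p.1 p.2.1 p.2.2 with hf
  have hf0 : ∀ x φ ε, x ∉ K → f (x, φ, ε) = 0 := fun x φ ε hx => by simp [hf, hχ0 x hx]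
  have hf1 : ContDiff ℝ (⊤ : ℕ∞) f := by
    rw [contDiff_iff_contDiffAt]
    rintro ⟨x, φ, ε⟩
    by_cases hx : x ∈ K
    · by_cases hε : ε ∈ Ioo (-ε₁) ε₁
      · have h1 := (hH.analytic (x, φ, ε) ⟨hKD hx, mem_univ _, hε⟩).contDiffAt (n := (⊤ : ℕ∞))
        have h2 : ContDiff ℝ (⊤ : ℕ∞) fun p : (ℝ × ℝ) × ℝ × ℝ => χ p.1 * ψ p.2.2 := by fun_prop
        exact h2.contDiffAt.mul h1
      · have h1 : ∀ᶠ p : (ℝ × ℝ) × ℝ × ℝ in 𝓝 (x, φ, ε), ε₁ / 2 < |p.2.2| := by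
          refine continuousAt_const.eventually_lt (by fun_prop) ?_
          have : ε₁ ≤ |ε| := by
            rw [mem_Ioo, ← abs_lt] at hε
            linarith
          show ε₁ / 2 < |ε|
          linarith
        refine (contDiffAt_const (c := (0 : ℝ))).congr_of_eventuallyEq ?_
        filter_upwards [h1] with p hp
        simp [hf, hψ0 _ hp.le]
    · refine (contDiffAt_const (c := (0 : ℝ))).congr_of_eventuallyEq ?_
      filter_upwards [eventually_fst_notMem hKc hx] with p hp using hf0 _ _ _ hp
  have hfper : ∀ x φ ε, f (x, φ + 2 * Real.pi, ε) = f (x, φ, ε) := by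
    intro x φ ε
    by_cases hx : x ∈ K
    · by_cases hε : ε ∈ Ioo (-ε₁) ε₁
      · have := hH.periodic x (hKD hx) ε hε φ
        simp only at this
        simp [hf, this]
      · have : ε₁ ≤ |ε| := by
          rw [mem_Ioo, ← abs_lt] at hε
          linarith
        simp [hf, hψ0 ε (by linarith)]
    · simp [hf0 _ _ _ hx]
  have hfφ : ∀ x φ, f (x, φ, 0) = f (x, 0, 0) := by
    intro x φ
    by_cases hx : x ∈ K
    · simp [hf, hH.eq_unperturbed hε₁ hK (hKD hx)]
    · simp [hf0 _ _ _ hx]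
  -- The Hadamard form of the quotient `(f (x, φ, ε) - f (x, φ, 0)) / ε`, smooth across `ε = 0`.
  set r : (ℝ × ℝ) × ℝ × ℝ → ℝ := fun p => ∫ s in (0 : ℝ)..1,
    fderiv ℝ f (p.1, p.2.1, s * p.2.2) (0, 0, 1) with hr
  have hr1 : ContDiff ℝ (⊤ : ℕ∞) r := by
    refine contDiff_integral (f := fun q : ((ℝ × ℝ) × ℝ × ℝ) × ℝ =>
      fderiv ℝ f (q.1.1, q.1.2.1, q.2 * q.1.2.2) (0, 0, 1)) ?_
    refine ContDiff.clm_apply ?_ contDiff_const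
    exact (contDiff_infty_iff_fderiv.1 hf1).2.comp (by fun_prop)
  have hrper : ∀ x φ ε, r (x, φ + 2 * Real.pi, ε) = r (x, φ, ε) := by
    intro x φ ε
    have h1 : (fun p : (ℝ × ℝ) × ℝ × ℝ => f (p + (0, 2 * Real.pi, 0))) = f := by
      ext ⟨x, φ, ε⟩
      simpa using hfper x φ ε
    simp only [hr]
    congr 1
    ext s
    have h2 := fderiv_comp_add_right (𝕜 := ℝ) (f := f) (x := (x, φ, s * ε)) (0, 2 * Real.pi, 0)
    rw [h1] at h2
    rw [h2]
    simp
  have hr0 : ∀ x φ ε, x ∉ K → r (x, φ, ε) = 0 := by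
    intro x φ ε hx
    have h3 : ∀ s : ℝ, fderiv ℝ f (x, φ, s * ε) = 0 := by
      intro s
      have h2 : f =ᶠ[𝓝 (x, φ, s * ε)] fun _ => 0 := by
        filter_upwards [eventually_fst_notMem hKc hx] with p hp using hf0 _ _ _ hp
      rw [h2.fderiv_eq]
      simp
    simp [hr, h3]
  -- A second factor `ψ` is needed because `r` averages over parameters `s * ε` down to zero and so
  -- need not vanish for large `ε`. The two constants are where `ψ` has become `0` and where it is
  -- still `1`.
  refine ⟨fun x => f (x, 0, 0), fun p => ψ p.2.2 * r p, K, N, ε₁ / 2, ε₁ / 4,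
    hf1.comp (by fun_prop), ContDiff.mul (by fun_prop) hr1, hKc, hN, hCN, hND, by linarith,
    fun x hx => hf0 x 0 0 hx, ?_, fun x φ ε => by simp [hrper], ?_⟩
  · rintro x φ ε (hx | hε)
    · simp [hr0 _ _ _ hx]
    · rw [mem_Icc, ← abs_le] at hε
      simp [hψ0 ε (by linarith)]
  · intro x hx φ ε hε
    have h1 := hadamard hf1 x φ ε
    rw [hfφ] at h1
    simp only [hψ1 ε hε.le, one_mul]
    rw [← h1]
    simp [hf, hχ1 x hx, hψ1 ε hε.le]

end ReducedHamiltonian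

/-! ### Parity and periodicity of the number of simple zeros. -/

section ZeroCount

variable {f : ℝ → ℝ}

theorem mul_pos_of_forall_ne_zero (hf : Continuous f) {a b : ℝ} (hab : a ≤ b)
    (h : ∀ x ∈ Icc a b, f x ≠ 0) : 0 < f a * f b := by
  by_contra hcon
  have hivt := intermediate_value_uIcc (f := f) (a := a) (b := b) hf.continuousOn
  rw [uIcc_of_le hab] at hivt
  obtain ⟨x, hx, hx0⟩ := hivt (show (0 : ℝ) ∈ uIcc (f a) (f b) by
    rw [mem_uIcc]
    rcases mul_nonpos_iff.1 (not_lt.1 hcon) with h1 | h1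
    · exact Or.inr ⟨h1.2, h1.1⟩
    · exact Or.inl ⟨h1.1, h1.2⟩)
  exact h x hx hx0

theorem eventually_mul_deriv_pos {z : ℝ} (hz : f z = 0) (hd : deriv f z ≠ 0) :
    (∀ᶠ y in 𝓝[>] z, 0 < f y * deriv f z) ∧ ∀ᶠ y in 𝓝[<] z, f y * deriv f z < 0 := by
  have h1 := hasDerivAt_iff_tendsto_slope.1 (differentiableAt_of_deriv_ne_zero hd).hasDerivAt
  have h2 : ∀ᶠ y in 𝓝[≠] z, 0 < slope f z y * deriv f z :=
    (h1.mul_const (deriv f z)).eventually_const_lt (mul_self_pos.2 hd)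
  have h3 : ∀ y, y ≠ z → f y * deriv f z = (y - z) * (slope f z y * deriv f z) := by
    intro y hy
    rw [slope_def_field, hz]
    field_simp [sub_ne_zero.2 hy]
    ring
  constructor
  · filter_upwards [h2.filter_mono (nhdsGT_le_nhdsNE z), self_mem_nhdsWithin] with y hy hy'
    rw [h3 y (ne_of_gt hy')]
    exact mul_pos (sub_pos.2 hy') hy
  · filter_upwards [h2.filter_mono (nhdsLT_le_nhdsNE z), self_mem_nhdsWithin] with y hy hy'
    rw [h3 y (ne_of_lt hy')]
    exact mul_neg_of_neg_of_pos (sub_neg.2 hy') hy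

/-- Over an interval a function with simple zeros changes its sign once for each zero. -/
theorem mul_pos_iff_even_ncard (hf : Continuous f) (hs : ∀ x, f x = 0 → deriv f x ≠ 0) {b : ℝ}
    (hb : f b ≠ 0) (N : ℕ) : ∀ a < b, f a ≠ 0 → {x ∈ Ioo a b | f x = 0}.Finite →
      {x ∈ Ioo a b | f x = 0}.ncard = N → (0 < f a * f b ↔ Even N) := by
  induction N with
  | zero =>
    intro a hab ha hfin hN
    rw [ncard_eq_zero hfin] at hN
    simp only [Even.zero, iff_true]
    refine mul_pos_of_forall_ne_zero hf hab.le fun x hx hx0 => ?_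
    have hxa : x ≠ a := fun h => ha (h ▸ hx0)
    have hxb : x ≠ b := fun h => hb (h ▸ hx0)
    have : x ∈ {x ∈ Ioo a b | f x = 0} :=
      ⟨⟨lt_of_le_of_ne hx.1 hxa.symm, lt_of_le_of_ne hx.2 hxb⟩, hx0⟩
    rw [hN] at this
    exact this
  | succ N ih =>
    intro a hab ha hfin hN
    have hne : {x ∈ Ioo a b | f x = 0}.Nonempty := by
      rw [← ncard_pos hfin]
      omega
    obtain ⟨z, ⟨hz, hz0⟩, hmin⟩ := hfin.exists_minimalFor id _ hne
    have hmin' : ∀ x ∈ Ioo a b, f x = 0 → z ≤ x := by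
      intro x hx hx0
      rcases le_total z x with h | h
      · exact h
      · exact hmin ⟨hx, hx0⟩ h
    obtain ⟨hright, hleft⟩ := eventually_mul_deriv_pos hz0 (hs z hz0)
    obtain ⟨d, hd, hda⟩ := (hleft.and (Ioo_mem_nhdsLT hz.1)).exists
    obtain ⟨u, hu, hu'⟩ := (mem_nhdsGT_iff_exists_Ioo_subset).1 hright
    -- A point past the smallest zero `z` with no zero in `(z, c]`: the sign has flipped once, and
    -- the induction hypothesis handles `(c, b)`.
    set c := (z + min u b) / 2 with hc
    have hzm : z < min u b := lt_min hu hz.2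
    have hzc : z < c := by linarith
    have hcm : c < min u b := by linarith
    have hcu : c < u := hcm.trans_le (min_le_left _ _)
    have hcb : c < b := hcm.trans_le (min_le_right _ _)
    have hfc : 0 < f c * deriv f z := hu' ⟨hzc, hcu⟩
    have hc0 : f c ≠ 0 := fun h => by simp [h] at hfc
    have had : 0 < f a * f d := mul_pos_of_forall_ne_zero hf hda.1.le fun x hx hx0 => by
      rcases eq_or_lt_of_le hx.1 with h | h
      · exact ha (h ▸ hx0)
      · exact absurd (hmin' x ⟨h, hx.2.trans_lt (hda.2.trans hz.2)⟩ hx0)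
          (not_le.2 (hx.2.trans_lt hda.2))
    have hac : f a * f c < 0 := by
      have h1 : 0 < (f a * f d) * (f c * deriv f z) := mul_pos had hfc
      have h2 : (f a * f d) * (f c * deriv f z) = (f a * f c) * (f d * deriv f z) := by ring
      rw [h2] at h1
      exact neg_of_mul_pos_left h1 hd.le
    have hset : {x ∈ Ioo c b | f x = 0} = {x ∈ Ioo a b | f x = 0} \ {z} := by
      ext x
      constructor
      · rintro ⟨hx, hx0⟩
        exact ⟨⟨⟨hz.1.trans (hzc.trans hx.1), hx.2⟩, hx0⟩, ne_of_gt (hzc.trans hx.1)⟩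
      · rintro ⟨⟨hx, hx0⟩, hxz⟩
        have hzx : z < x := lt_of_le_of_ne (hmin' x hx hx0) (Ne.symm hxz)
        refine ⟨⟨?_, hx.2⟩, hx0⟩
        by_contra hcx
        have := hu' ⟨hzx, (not_lt.1 hcx).trans_lt hcu⟩
        simp [hx0] at this
    have hcard : {x ∈ Ioo c b | f x = 0}.ncard = N := by
      have hzmem : z ∈ {x ∈ Ioo a b | f x = 0} := ⟨hz, hz0⟩
      rw [hset, ncard_sdiff_singleton_of_mem hzmem, hN]
      rfl
    have hiff := ih c hcb hc0 (hset ▸ hfin.sdiff) hcard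
    rw [Nat.even_add_one, ← hiff]
    have hcc : 0 < f c * f c := mul_self_pos.2 hc0
    have heq : (f a * f b) * (f c * f c) = (f a * f c) * (f c * f b) := by ring
    constructor
    · intro h1 h2
      have h3 : 0 < (f a * f c) * (f c * f b) := heq ▸ mul_pos h1 hcc
      exact absurd h3 (not_lt.2 (mul_nonpos_of_nonpos_of_nonneg hac.le h2.le))
    · intro h1
      have h2 : f c * f b < 0 := lt_of_le_of_ne (not_lt.1 h1) (mul_ne_zero hc0 hb)
      have h3 : 0 < (f a * f b) * (f c * f c) := heq ▸ mul_pos_of_neg_of_neg hac h2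
      exact pos_of_mul_pos_left h3 hcc.le

/-- The number of zeros in `[s, t)`. -/
noncomputable def zeroCount (f : ℝ → ℝ) (s t : ℝ) : ℕ∞ := {x ∈ Ico s t | f x = 0}.encard

theorem zeroCount_add {s t u : ℝ} (hst : s ≤ t) (htu : t ≤ u) :
    zeroCount f s t + zeroCount f t u = zeroCount f s u := by
  unfold zeroCount
  rw [← encard_union_eq]
  · congr 1
    ext x
    simp only [mem_union, mem_ofPred_eq, ← Ico_union_Ico_eq_Ico hst htu]
    tauto
  · rw [disjoint_left]
    rintro x ⟨h1, -⟩ ⟨h2, -⟩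
    exact absurd h1.2 (not_lt.2 h2.1)

theorem zeroCount_add_period {p : ℝ} (hp : Function.Periodic f p) (s t : ℝ) :
    zeroCount f (s + p) (t + p) = zeroCount f s t := by
  unfold zeroCount
  rw [← (add_left_injective p).encard_image {x ∈ Ico s t | f x = 0}]
  congr 1
  ext x
  simp only [mem_image, mem_ofPred_eq, mem_Ico]
  constructor
  · rintro ⟨⟨h1, h2⟩, h3⟩
    refine ⟨x - p, ⟨⟨by linarith, by linarith⟩, ?_⟩, by ring⟩
    rw [hp.sub_eq, h3]
  · rintro ⟨y, ⟨⟨h1, h2⟩, h3⟩, rfl⟩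
    exact ⟨⟨by linarith, by linarith⟩, by rw [hp y, h3]⟩

theorem zeroCount_nat_mul {p : ℝ} (hp0 : 0 ≤ p) (hp : Function.Periodic f p) (m : ℕ) :
    zeroCount f 0 (m * p) = m * zeroCount f 0 p := by
  induction m with
  | zero => simp [zeroCount]
  | succ m ih =>
    rw [← zeroCount_add (t := m * p) (by positivity) (by push_cast; nlinarith), ih]
    have h1 := zeroCount_add_period (hp.nat_mul m) 0 p
    rw [zero_add] at h1
    rw [show ((m + 1 : ℕ) : ℝ) * p = p + m * p by push_cast; ring, h1]
    push_cast
    ring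

/-- The interval consists of `m` periods with equally many zeros each. Over one period the end
values agree, so the number of sign changes is even. -/
theorem exists_eq_two_mul_of_simple_zeros (hf : Continuous f) {p : ℝ} (hp0 : 0 < p)
    (hp : Function.Periodic f p) {m j : ℕ} (hm : 0 < m)
    (hj : {x ∈ Ico 0 (m * p) | f x = 0}.encard = j)
    (hs : ∀ x ∈ Ico 0 (m * p), f x = 0 → deriv f x ≠ 0) : ∃ k : ℕ, j = 2 * k * m := by
  have hm1 : (1 : ℝ) ≤ m := by exact_mod_cast hm
  have hdper : Function.Periodic (deriv f) p := fun x => by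
    rw [← deriv_comp_add_const, show (fun x => f (x + p)) = f from funext hp]
  have hs' : ∀ x, f x = 0 → deriv f x ≠ 0 := by
    intro x hx
    obtain ⟨y, hy, hxy⟩ : ∃ y ∈ Ico 0 p, f x = f y ∧ deriv f x = deriv f y := by
      refine ⟨toIcoMod hp0 0 x, by simpa using toIcoMod_mem_Ico hp0 0 x, ?_⟩
      rw [toIcoMod, hp.sub_zsmul_eq, hdper.sub_zsmul_eq]
      exact ⟨rfl, rfl⟩
    rw [hxy.2]
    exact hs y ⟨hy.1, hy.2.trans_le (by nlinarith)⟩ (hxy.1 ▸ hx)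
  have h1 : (m : ℕ∞) * zeroCount f 0 p = j := by
    rw [← zeroCount_nat_mul hp0.le hp, ← hj]
    rfl
  have hfin : zeroCount f 0 p ≠ ⊤ := by
    intro h
    rw [h, ENat.mul_top (by exact_mod_cast hm.ne')] at h1
    exact ENat.top_ne_natCast j h1
  obtain ⟨r, hr⟩ := ENat.ne_top_iff_exists.1 hfin
  rw [← hr] at h1
  have h2 : m * r = j := by exact_mod_cast h1
  -- The period is restarted at a point that is not a zero, so that the sign at its ends makes
  -- sense.
  obtain ⟨a, ha, ha0⟩ : ∃ a ∈ Ico 0 p, f a ≠ 0 := by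
    by_contra! hcon
    have : {x ∈ Ico 0 p | f x = 0} = Ico 0 p := by
      ext x
      simpa using fun h1 h2 => hcon x ⟨h1, h2⟩
    unfold zeroCount at hfin
    rw [this] at hfin
    exact hfin (Ico_infinite hp0).encard_eq
  have h3 : zeroCount f a (a + p) = r := by
    rw [← zeroCount_add (t := p) ha.2.le (by linarith [ha.1])]
    have := zeroCount_add_period hp 0 a
    rw [zero_add] at this
    rw [this, add_comm, zeroCount_add ha.1 ha.2.le, hr]
  have h4 : {x ∈ Ico a (a + p) | f x = 0} = {x ∈ Ioo a (a + p) | f x = 0} := by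
    ext x
    constructor
    · rintro ⟨hx, hx0⟩
      exact ⟨⟨lt_of_le_of_ne hx.1 fun h => ha0 (h ▸ hx0), hx.2⟩, hx0⟩
    · rintro ⟨hx, hx0⟩
      exact ⟨Ioo_subset_Ico_self hx, hx0⟩
  unfold zeroCount at h3
  rw [h4] at h3
  have hfa : f (a + p) = f a := hp a
  have h5 := mul_pos_iff_even_ncard hf hs' (b := a + p) (by rwa [hfa]) r a (by linarith) ha0
    (finite_of_encard_eq_coe h3) (by rw [ncard, h3]; rfl)
  rw [hfa] at h5
  obtain ⟨k, hk⟩ := h5.1 (mul_self_pos.2 ha0)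
  exact ⟨k, by rw [← h2, hk]; ring⟩

/-- By Bézout, `T / n` is an integer combination of the two given periods. -/
theorem periodic_div_of_coprime {T : ℝ} {m n : ℕ} (hn : 0 < n) (hmn : Nat.Coprime m n)
    (h1 : Function.Periodic f T) (h2 : Function.Periodic f (T * m / n)) :
    Function.Periodic f (T / n) := by
  have hb := Nat.gcd_eq_gcd_ab m n
  rw [hmn.gcd_eq_one] at hb
  have hb' : (1 : ℝ) = m * (m.gcdA n : ℝ) + n * (m.gcdB n : ℝ) := by exact_mod_cast hb
  have h3 := (h2.int_mul (m.gcdA n)).add_period (h1.int_mul (m.gcdB n))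
  have hn' : (n : ℝ) ≠ 0 := by exact_mod_cast hn.ne'
  have h4 : T / n = m.gcdA n * (T * m / n) + m.gcdB n * T := by
    field_simp
    linear_combination T * hb'
  rw [h4]
  exact h3

end ZeroCount

/-! ### Flow of the model system and its energy balance. -/

section ModelFlow

/-- The Hamiltonian vector field of `K₀ + ε R`. -/
noncomputable def modelVec (K₀ : ℝ × ℝ → ℝ) (R : (ℝ × ℝ) × ℝ × ℝ → ℝ) (x : ℝ × ℝ) (φ ε : ℝ) :
    ℝ × ℝ :=
  hamVec K₀ x + ε • hamVec (fun y => R (y, φ, ε)) x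

/-- The rate of change `{K₀, R}` of the energy `K₀`, divided by `ε`. -/
noncomputable def energyRate (K₀ : ℝ × ℝ → ℝ) (R : (ℝ × ℝ) × ℝ × ℝ → ℝ) (x : ℝ × ℝ) (φ ε : ℝ) : ℝ :=
  fderiv ℝ K₀ x (hamVec (fun y => R (y, φ, ε)) x)

/-- `X t x ε` is the solution of the system with Hamiltonian `K₀ + ε R` that starts at `x` at time
`0`, and `G t x ε` the integral of `energyRate` along it. -/
structure IsModelFlow (K₀ : ℝ × ℝ → ℝ) (R : (ℝ × ℝ) × ℝ × ℝ → ℝ) (X : ℝ → ℝ × ℝ → ℝ → ℝ × ℝ)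
    (G : ℝ → ℝ × ℝ → ℝ → ℝ) : Prop where
  zero : ∀ x ε, X 0 x ε = x
  hasDerivAt : ∀ x ε t, HasDerivAt (fun s => X s x ε) (modelVec K₀ R (X t x ε) t ε) t
  continuous : Continuous fun p : ℝ × (ℝ × ℝ) × ℝ => X p.1 p.2.1 p.2.2
  integral_zero : ∀ x ε, G 0 x ε = 0
  integral_hasDerivAt : ∀ x ε t,
    HasDerivAt (fun s => G s x ε) (energyRate K₀ R (X t x ε) t ε) t
  strict : ∀ t, 0 ≤ t → ∀ x ε, ∃ S' : ℝ × (ℝ × ℝ) →L[ℝ] (ℝ × ℝ) × ℝ,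
    HasStrictFDerivAt (fun v : ℝ × (ℝ × ℝ) => (X t v.2 v.1, G t v.2 v.1)) S' (ε, x)
  lipschitz : ∃ L : NNReal, ∀ φ ε, LipschitzWith L fun x => modelVec K₀ R x φ ε

variable {K₀ : ℝ × ℝ → ℝ} {R : (ℝ × ℝ) × ℝ × ℝ → ℝ} {K : Set (ℝ × ℝ)} {c : ℝ}

theorem hamVec_section (hR : Differentiable ℝ R) (x : ℝ × ℝ) (φ ε : ℝ) :
    hamVec (fun y => R (y, φ, ε)) x =
      (fderiv ℝ R (x, φ, ε) ((0, 1), 0, 0), -fderiv ℝ R (x, φ, ε) ((1, 0), 0, 0)) := by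
  have h := (hR (x, φ, ε)).hasFDerivAt.comp (f := fun y : ℝ × ℝ => (y, φ, ε)) x
    (hasFDerivAt_prodMk_left x (φ, ε))
  have h' : fderiv ℝ (fun y => R (y, φ, ε)) x =
      (fderiv ℝ R (x, φ, ε)).comp (.inl ℝ (ℝ × ℝ) (ℝ × ℝ)) := h.fderiv
  unfold hamVec
  rw [h']
  simp
  constructor <;> rfl

theorem contDiff_hamVec {n : WithTop ℕ∞} {A : ℝ × ℝ → ℝ} (hA : ContDiff ℝ (n + 1) A) :
    ContDiff ℝ n (hamVec A) := by
  have := hA.fderiv_right (m := n) le_rfl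
  exact (this.clm_apply contDiff_const).prodMk (this.clm_apply contDiff_const).neg

theorem contDiff_hamVec_section {n : WithTop ℕ∞} (hR : ContDiff ℝ (n + 1) R) :
    ContDiff ℝ n fun p : (ℝ × ℝ) × ℝ × ℝ => hamVec (fun y => R (y, p.2.1, p.2.2)) p.1 := by
  have h := hR.fderiv_right (m := n) le_rfl
  have h1 : (fun p : (ℝ × ℝ) × ℝ × ℝ => hamVec (fun y => R (y, p.2.1, p.2.2)) p.1) = fun p =>
      (fderiv ℝ R p ((0, 1), 0, 0), -fderiv ℝ R p ((1, 0), 0, 0)) := by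
    ext1 p
    exact hamVec_section (hR.differentiable (by simp)) _ _ _
  rw [h1]
  exact (h.clm_apply contDiff_const).prodMk (h.clm_apply contDiff_const).neg

theorem hamVec_eq_zero_of_notMem {A : ℝ × ℝ → ℝ} (hK : IsCompact K) (h0 : ∀ x ∉ K, A x = 0)
    {x : ℝ × ℝ} (hx : x ∉ K) : hamVec A x = 0 := by
  have : A =ᶠ[𝓝 x] fun _ => 0 := by
    filter_upwards [hK.isClosed.isOpen_compl.mem_nhds hx] with y hy using h0 y hy
  simp [hamVec, this.fderiv_eq]

theorem fderiv_hamVec_self (A : ℝ × ℝ → ℝ) (x : ℝ × ℝ) : fderiv ℝ A x (hamVec A x) = 0 := by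
  have h : hamVec A x = (fderiv ℝ A x (0, 1)) • ((1, 0) : ℝ × ℝ) +
      (-fderiv ℝ A x (1, 0)) • ((0, 1) : ℝ × ℝ) := by
    simp [hamVec]
  rw [h, map_add, map_smul, map_smul]
  simp only [smul_eq_mul]
  ring

/-- Time, parameter and accumulated energy integral become extra coordinates of an autonomous
system. Differentiability in the initial point then covers `X` and `G` jointly in `x` and `ε`. -/
theorem exists_isModelFlow (hK₀ : ContDiff ℝ (⊤ : ℕ∞) K₀) (hR : ContDiff ℝ (⊤ : ℕ∞) R)
    (hK : IsCompact K) (hK₀0 : ∀ x ∉ K, K₀ x = 0)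
    (hR0 : ∀ x φ ε, x ∉ K ∨ ε ∉ Icc (-c) c → R (x, φ, ε) = 0)
    (hper : ∀ x φ ε, R (x, φ + 2 * Real.pi, ε) = R (x, φ, ε)) :
    ∃ X G, IsModelFlow K₀ R X G := by
  have hV : ContDiff ℝ 1 (hamVec K₀) := contDiff_hamVec (hK₀.of_le (by norm_cast))
  have hVs : HasCompactSupport (hamVec K₀) :=
    HasCompactSupport.intro hK fun x hx => hamVec_eq_zero_of_notMem hK hK₀0 hx
  set W : (ℝ × ℝ) × ℝ × ℝ → ℝ × ℝ := fun p => hamVec (fun y => R (y, p.2.1, p.2.2)) p.1 with hW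
  have hW1 : ContDiff ℝ 1 W := contDiff_hamVec_section (hR.of_le (by norm_cast))
  have hW0 : ∀ x φ ε, x ∉ K ∨ ε ∉ Icc (-c) c → W (x, φ, ε) = 0 := by
    rintro x φ ε (hx | hε)
    · exact hamVec_eq_zero_of_notMem hK (fun y hy => hR0 y φ ε (Or.inl hy)) hx
    · have : (fun y => R (y, φ, ε)) = fun _ => 0 := funext fun y => hR0 y φ ε (Or.inr hε)
      simp [hW, hamVec, this]
  have hWper : ∀ x φ ε, W (x, φ + 2 * Real.pi, ε) = W (x, φ, ε) := by
    intro x φ ε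
    simp only [hW, hper]
  -- the bounded part of the vector field on the extended space
  set f : (ℝ × ℝ) × ℝ × ℝ → (ℝ × ℝ) × ℝ := fun p => (p.2.2 • W p, fderiv ℝ K₀ p.1 (W p)) with hf
  have hf1 : ContDiff ℝ 1 f := by
    refine ContDiff.prodMk (ContDiff.smul contDiff_snd.snd hW1) (ContDiff.clm_apply ?_ hW1)
    exact ((contDiff_infty_iff_fderiv.1 hK₀).2.of_le (by norm_cast)).comp contDiff_fst
  have hf0 : ∀ x φ ε, x ∉ K ∨ ε ∉ Icc (-c) c → f (x, φ, ε) = 0 := by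
    intro x φ ε h
    simp [hf, hW0 x φ ε h]
  have hfper : ∀ x φ ε, f (x, φ + 2 * Real.pi, ε) = f (x, φ, ε) := by
    intro x φ ε
    simp only [hf, hWper]
  obtain ⟨B₁, hB₁⟩ := hV.continuous.bounded_above_of_compact_support hVs
  obtain ⟨L₁, hL₁⟩ := hV.lipschitzWith_of_hasCompactSupport hVs one_ne_zero
  obtain ⟨B₂, hB₂⟩ := exists_bound_of_periodic hf1.continuous hK hfper hf0
  obtain ⟨L₂, hL₂⟩ := exists_lipschitz_of_periodic hf1 hK hfper hf0
  -- The coordinates are position, time (speed `1`), parameter (speed `0`) and integral.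
  let Y : (ℝ × ℝ) × ℝ × ℝ × ℝ → (ℝ × ℝ) × ℝ × ℝ × ℝ := fun p =>
    (hamVec K₀ p.1 + (f (p.1, p.2.1, p.2.2.1)).1, 1, 0, (f (p.1, p.2.1, p.2.2.1)).2)
  have hY1 : ContDiff ℝ 1 Y := by
    have h1 : ContDiff ℝ 1 fun p : (ℝ × ℝ) × ℝ × ℝ × ℝ => f (p.1, p.2.1, p.2.2.1) :=
      hf1.comp (by fun_prop)
    exact ((hV.comp contDiff_fst).add h1.fst).prodMk
      (contDiff_const.prodMk (contDiff_const.prodMk h1.snd))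
  have hproj := (LipschitzWith.prod_fst (α := ℝ × ℝ) (β := ℝ × ℝ × ℝ)).prodMk
    ((LipschitzWith.prod_fst.comp LipschitzWith.prod_snd).prodMk
      ((LipschitzWith.prod_fst.comp LipschitzWith.prod_snd).comp LipschitzWith.prod_snd))
  have hYL : ∃ L : NNReal, LipschitzWith L Y := by
    have h2 := (hL₂.comp hproj)
    have h3 := (hL₁.comp LipschitzWith.prod_fst).add (LipschitzWith.prod_fst.comp h2)
    exact ⟨_, h3.prodMk ((LipschitzWith.const 1).prodMk ((LipschitzWith.const 0).prodMk
      (LipschitzWith.prod_snd.comp h2)))⟩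
  obtain ⟨L, hL⟩ := hYL
  have hYB : ∀ p, ‖Y p‖ ≤ max (B₁ + B₂) (max 1 B₂) := by
    intro p
    have h1 := hB₁ p.1
    have h2 := hB₂ (p.1, p.2.1, p.2.2.1)
    have h3 := (norm_fst_le _).trans h2
    have h4 := (norm_snd_le _).trans h2
    have h5 : 0 ≤ B₂ := (norm_nonneg _).trans h2
    simp only [Y, Prod.norm_def]
    refine max_le_max ?_ (max_le_max (by simp) (max_le (by simpa using h5) h4))
    rw [← Prod.norm_def]
    exact (norm_add_le _ _).trans (add_le_add h1 h3)
  obtain ⟨Φ, hΦ⟩ := exists_isFlow hL hYB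
  have hd : ∀ p t, HasDerivAt (fun s => Φ s p) (Y (Φ t p)) t := fun p t => (hΦ p).2 t
  have htime : ∀ x ε t, (Φ t (x, 0, ε, 0)).2.1 = t := by
    intro x ε t
    have := eq_of_hasDerivAt_of_lipschitz (K := 0) (v := fun _ _ => (1 : ℝ))
      (fun _ => LipschitzWith.const 1)
      (f := fun s => (Φ s (x, 0, ε, 0)).2.1) (g := fun s => s)
      (fun s => (hd (x, 0, ε, 0) s).snd.fst) (fun s => hasDerivAt_id s) 0 (by simp [(hΦ _).1])
    exact congrFun this t
  have heps : ∀ x ε t, (Φ t (x, 0, ε, 0)).2.2.1 = ε := by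
    intro x ε t
    have := eq_of_hasDerivAt_of_lipschitz (K := 0) (v := fun _ _ => (0 : ℝ))
      (fun _ => LipschitzWith.const 0)
      (f := fun s => (Φ s (x, 0, ε, 0)).2.2.1) (g := fun _ => ε)
      (fun s => (hd (x, 0, ε, 0) s).snd.snd.fst) (fun s => hasDerivAt_const s ε) 0
      (by simp [(hΦ _).1])
    exact congrFun this t
  have hmodel : ∀ x φ ε, modelVec K₀ R x φ ε = hamVec K₀ x + (f (x, φ, ε)).1 := fun _ _ _ => rfl
  refine ⟨fun t x ε => (Φ t (x, 0, ε, 0)).1, fun t x ε => (Φ t (x, 0, ε, 0)).2.2.2,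
    fun x ε => by simp [(hΦ _).1], fun x ε t => ?_, ?_, fun x ε => by simp [(hΦ _).1],
    fun x ε t => ?_, fun t ht x ε => ?_, ⟨L₁ + L₂, fun φ ε => ?_⟩⟩
  · have := (hd (x, 0, ε, 0) t).fst
    simp only [Y, htime, heps] at this
    rw [hmodel]
    exact this
  · exact ((hΦ.continuous hL).comp (f := fun p : ℝ × (ℝ × ℝ) × ℝ =>
      (p.1, (p.2.1, (0 : ℝ), p.2.2, (0 : ℝ)))) (by fun_prop)).fst
  · have := (hd (x, 0, ε, 0) t).snd.snd.snd
    simp only [Y, htime, heps] at this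
    exact this
  · obtain ⟨Φ', hΦ'⟩ := hΦ.exists_hasStrictFDerivAt hL hY1 ht (x, 0, ε, 0)
    have h1 : ContDiff ℝ 1 fun v : ℝ × (ℝ × ℝ) => (v.2, (0 : ℝ), v.1, (0 : ℝ)) := by fun_prop
    have h2 := h1.contDiffAt.hasStrictFDerivAt (x := (ε, x)) one_ne_zero
    have h3 : ContDiff ℝ 1 fun p : (ℝ × ℝ) × ℝ × ℝ × ℝ => (p.1, p.2.2.2) := by fun_prop
    have h4 := h3.contDiffAt.hasStrictFDerivAt (x := Φ t (x, 0, ε, 0)) one_ne_zero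
    exact ⟨_, h4.comp (ε, x) (hΦ'.comp (ε, x) h2)⟩
  · have h1 : LipschitzWith 1 fun x : ℝ × ℝ => (x, φ, ε) := LipschitzWith.prodMk_right (φ, ε)
    have h2 := hL₁.add (LipschitzWith.prod_fst.comp (hL₂.comp h1))
    simpa [hmodel] using h2

namespace IsModelFlow

variable {X : ℝ → ℝ × ℝ → ℝ → ℝ × ℝ} {G : ℝ → ℝ × ℝ → ℝ → ℝ}

theorem eq_flow (h : IsModelFlow K₀ R X G) {ε : ℝ} {y : ℝ → ℝ × ℝ}
    (hy : ∀ t, HasDerivAt y (modelVec K₀ R (y t) t ε) t) (t : ℝ) : y t = X t (y 0) ε := by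
  obtain ⟨L, hL⟩ := h.lipschitz
  have := eq_of_hasDerivAt_of_lipschitz (v := fun t x => modelVec K₀ R x t ε) (fun t => hL t ε) hy
    (fun t => h.hasDerivAt (y 0) ε t) 0 (h.zero _ _).symm
  exact congrFun this t

theorem modelVec_unperturbed (K₀ : ℝ × ℝ → ℝ) (R : (ℝ × ℝ) × ℝ × ℝ → ℝ) (x : ℝ × ℝ) (φ : ℝ) :
    modelVec K₀ R x φ 0 = hamVec K₀ x := by
  simp [modelVec]

theorem hasDerivAt_unperturbed (h : IsModelFlow K₀ R X G) (x : ℝ × ℝ) (t : ℝ) :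
    HasDerivAt (fun s => X s x 0) (hamVec K₀ (X t x 0)) t := by
  simpa [modelVec_unperturbed] using h.hasDerivAt x 0 t

theorem add_unperturbed (h : IsModelFlow K₀ R X G) (s t : ℝ) (x : ℝ × ℝ) :
    X (s + t) x 0 = X s (X t x 0) 0 := by
  have := h.eq_flow (ε := 0) (y := fun s => X (s + t) x 0) (fun s => by
    rw [modelVec_unperturbed]
    exact (h.hasDerivAt_unperturbed x (s + t)).comp_add_const s t) s
  simpa using this

theorem lipschitz_unperturbed (h : IsModelFlow K₀ R X G) :
    ∃ L : NNReal, LipschitzWith L (hamVec K₀) := by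
  obtain ⟨L, hL⟩ := h.lipschitz
  exact ⟨L, by simpa [modelVec_unperturbed] using hL 0 0⟩

/-- Only the `ε` part of the field changes `K₀`. For `ε ≠ 0` this turns conservation over a return
into `G = 0`, a condition that stays meaningful at `ε = 0`. -/
theorem energy (h : IsModelFlow K₀ R X G) (hK₀ : Differentiable ℝ K₀) (t : ℝ) (x : ℝ × ℝ) (ε : ℝ) :
    K₀ (X t x ε) = K₀ x + ε * G t x ε := by
  have h1 : ∀ t, HasDerivAt (fun t => K₀ (X t x ε) - ε * G t x ε) 0 t := by
    intro t
    have h2 := (hK₀ (X t x ε)).hasFDerivAt.comp_hasDerivAt t (h.hasDerivAt x ε t)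
    have h3 := h2.sub ((h.integral_hasDerivAt x ε t).const_mul ε)
    have h4 : fderiv ℝ K₀ (X t x ε) (modelVec K₀ R (X t x ε) t ε) -
        ε * energyRate K₀ R (X t x ε) t ε = 0 := by
      simp [modelVec, fderiv_hamVec_self, energyRate]
    rw [h4] at h3
    exact h3
  have h4 := is_const_of_deriv_eq_zero (fun t => (h1 t).differentiableAt)
    (fun t => (h1 t).deriv) t 0
  simp only [h.zero, h.integral_zero] at h4
  linarith

theorem periodic (h : IsModelFlow K₀ R X G)
    (hper : ∀ x φ ε, R (x, φ + 2 * Real.pi, ε) = R (x, φ, ε)) {l : ℕ} {x : ℝ × ℝ} {ε : ℝ}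
    (hx : X (2 * Real.pi * l) x ε = x) : Function.Periodic (fun t => X t x ε) (2 * Real.pi * l) := by
  intro t
  have hR : ∀ y φ, R (y, φ + 2 * Real.pi * l, ε) = R (y, φ, ε) := fun y φ => by
    have : Function.Periodic (fun φ => R (y, φ, ε)) (2 * Real.pi) := fun φ => hper y φ ε
    simpa [mul_comm] using this.nat_mul l φ
  have := h.eq_flow (ε := ε) (y := fun t => X (t + 2 * Real.pi * l) x ε) (fun t => by
    have h1 := (h.hasDerivAt x ε (t + 2 * Real.pi * l)).comp_add_const t (2 * Real.pi * l)
    simp only [modelVec, hR] at h1 ⊢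
    exact h1) t
  simpa [hx] using this

end IsModelFlow

end ModelFlow

/-! ### Branches of zeros and uniformity over a compact set. -/

section ImplicitBranch

/-- An injective endomorphism of the plane is invertible, so the implicit function theorem applies.
Its uniqueness half is what makes the later count exact. -/
theorem exists_zero_branch {S : ℝ × (ℝ × ℝ) → ℝ × ℝ} {S' : ℝ × (ℝ × ℝ) →L[ℝ] ℝ × ℝ}
    {c : ℝ × ℝ} (hS : HasStrictFDerivAt S S' (0, c)) (h0 : S (0, c) = 0)
    (hinj : ∀ w, S' (0, w) = 0 → w = 0) :
    ∃ z : ℝ → ℝ × ℝ, Tendsto z (𝓝 0) (𝓝 c) ∧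
      ∀ᶠ v in 𝓝 ((0 : ℝ), c), S v = 0 ↔ z v.1 = v.2 := by
  have hinv : (S' ∘SL ContinuousLinearMap.inr ℝ ℝ (ℝ × ℝ)).IsInvertible := by
    have hker : Function.Injective (S' ∘SL ContinuousLinearMap.inr ℝ ℝ (ℝ × ℝ)).toLinearMap := by
      rw [injective_iff_map_eq_zero]
      intro w hw
      exact hinj w (by simpa using hw)
    exact ⟨(LinearEquiv.ofInjectiveEndo _ hker).toContinuousLinearEquiv, by ext <;> simp⟩
  refine ⟨hS.implicitFunctionOfProdDomain hinv, hS.tendsto_implicitFunctionOfProdDomain hinv, ?_⟩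
  simpa [h0] using hS.eventually_apply_eq_iff_implicitFunctionOfProdDomain hinv

/-- The tube lemma: one neighbourhood of `C` and one range of parameters serve all its points. -/
theorem exists_isOpen_of_eventually {E : Type*} [TopologicalSpace E] {C : Set E}
    (hC : IsCompact C) {Q : ℝ × E → Prop} (h : ∀ c ∈ C, ∀ᶠ v in 𝓝 ((0 : ℝ), c), Q v) :
    ∃ U : Set E, IsOpen U ∧ C ⊆ U ∧ ∀ᶠ ε in 𝓝 (0 : ℝ), ∀ x ∈ U, Q (ε, x) := by
  have h1 : {v | Q v} ∈ 𝓝 (0 : ℝ) ×ˢ 𝓝ˢ C :=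
    hC.mem_prod_nhdsSet_of_forall fun c hc => by
      rw [← nhds_prod_eq]
      exact h c hc
  obtain ⟨s, hs, t, ht, hst⟩ := mem_prod_iff.1 h1
  obtain ⟨U, hU, hCU, hUt⟩ := mem_nhdsSet_iff_exists.1 ht
  exact ⟨U, hU, hCU, by filter_upwards [hs] with ε hε x hx using hst ⟨hε, hUt hx⟩⟩

end ImplicitBranch

/-! ### Comparison of the reduced Hamiltonian with its model. -/

section LocalModel

/-- On the open set `N` and for `|ε| < δ` the reduced Hamiltonian `H` is `K₀ + ε R`. -/
structure IsLocalModel (H : ℝ × ℝ → ℝ → ℝ → ℝ) (K₀ : ℝ × ℝ → ℝ) (R : (ℝ × ℝ) × ℝ × ℝ → ℝ)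
    (N : Set (ℝ × ℝ)) (δ : ℝ) : Prop where
  isOpen : IsOpen N
  pos : 0 < δ
  smooth_K₀ : ContDiff ℝ (⊤ : ℕ∞) K₀
  smooth_R : ContDiff ℝ (⊤ : ℕ∞) R
  periodic : ∀ x φ ε, R (x, φ + 2 * Real.pi, ε) = R (x, φ, ε)
  eq : ∀ x ∈ N, ∀ φ ε, |ε| < δ → H x φ ε = K₀ x + ε * R (x, φ, ε)

variable {H : ℝ × ℝ → ℝ → ℝ → ℝ} {K₀ : ℝ × ℝ → ℝ} {R : (ℝ × ℝ) × ℝ × ℝ → ℝ}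
  {N : Set (ℝ × ℝ)} {δ : ℝ} {X : ℝ → ℝ × ℝ → ℝ → ℝ × ℝ} {G : ℝ → ℝ × ℝ → ℝ → ℝ}

namespace IsLocalModel

theorem differentiable_K₀ (h : IsLocalModel H K₀ R N δ) : Differentiable ℝ K₀ :=
  h.smooth_K₀.differentiable (by simp)

theorem hamVec_eq (h : IsLocalModel H K₀ R N δ) {x : ℝ × ℝ} (hx : x ∈ N) (φ : ℝ) {ε : ℝ}
    (hε : |ε| < δ) : hamVec (fun y => H y φ ε) x = modelVec K₀ R x φ ε := by
  have h1 : (fun y => H y φ ε) =ᶠ[𝓝 x] fun y => K₀ y + ε * R (y, φ, ε) := by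
    filter_upwards [h.isOpen.mem_nhds hx] with y hy using h.eq y hy φ ε hε
  have h2 : Differentiable ℝ fun y => R (y, φ, ε) :=
    (h.smooth_R.differentiable (by simp)).comp (by fun_prop)
  have h3 := ((h.differentiable_K₀ x).hasFDerivAt.add ((h2 x).hasFDerivAt.const_mul ε)).fderiv
  have h4 : fderiv ℝ (fun y => H y φ ε) x = fderiv ℝ K₀ x + ε • fderiv ℝ (fun y => R (y, φ, ε)) x :=
    h1.fderiv_eq.trans h3
  simp only [hamVec, modelVec, h4]
  ext <;> simp
  ring

theorem H₀_eq (h : IsLocalModel H K₀ R N δ) {x : ℝ × ℝ} (hx : x ∈ N) : H₀ H x = K₀ x := by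
  have := h.eq x hx 0 0 (by simpa using h.pos)
  simpa [H₀] using this

theorem H₁_eq (h : IsLocalModel H K₀ R N δ) {x : ℝ × ℝ} (hx : x ∈ N) (φ : ℝ) :
    H₁ H φ x = R (x, φ, 0) := by
  have h1 : (fun ε => H x φ ε) =ᶠ[𝓝 0] fun ε => K₀ x + ε * R (x, φ, ε) := by
    filter_upwards [Metric.ball_mem_nhds (0 : ℝ) h.pos] with ε hε
    exact h.eq x hx φ ε (by simpa using hε)
  have h2 : Differentiable ℝ fun ε => R (x, φ, ε) :=
    (h.smooth_R.differentiable (by simp)).comp (by fun_prop)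
  have h3 : HasDerivAt (fun ε => K₀ x + ε * R (x, φ, ε)) (R (x, φ, 0)) 0 := by
    simpa using ((hasDerivAt_id (0 : ℝ)).mul (h2 0).hasDerivAt).const_add (K₀ x)
  rw [H₁, h1.deriv_eq, h3.deriv]

theorem poisson_eq (h : IsLocalModel H K₀ R N δ) {x : ℝ × ℝ} (hx : x ∈ N) (φ : ℝ) :
    poisson (H₀ H) (H₁ H φ) x = energyRate K₀ R x φ 0 := by
  have h1 : H₀ H =ᶠ[𝓝 x] K₀ := by
    filter_upwards [h.isOpen.mem_nhds hx] with y hy using h.H₀_eq hy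
  have h2 : H₁ H φ =ᶠ[𝓝 x] fun y => R (y, φ, 0) := by
    filter_upwards [h.isOpen.mem_nhds hx] with y hy using h.H₁_eq hy φ
  have h3 : ∀ v : ℝ × ℝ, v = v.1 • ((1, 0) : ℝ × ℝ) + v.2 • ((0, 1) : ℝ × ℝ) := fun v => by
    ext <;> simp
  rw [poisson, energyRate, h1.fderiv_eq, h2.fderiv_eq,
    h3 (hamVec (fun y => R (y, φ, 0)) x), map_add, map_smul, map_smul]
  simp only [hamVec, smul_eq_mul]
  ring

end IsLocalModel

end LocalModel

/-! ### Uniqueness for a curve that solves the equation only inside an open set. -/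

section Uniqueness

variable {E : Type*} [NormedAddCommGroup E] [NormedSpace ℝ E] {V : E → E} {L : NNReal}

/-- At a time of agreement `y` lies in `N` because `u` does, so agreement continues a little
further; the set of such times is also closed. -/
theorem eqOn_of_mem_open (hV : LipschitzWith L V) {N : Set E} (hN : IsOpen N) {u y : ℝ → E} {B : ℝ}
    (hu : ∀ t, HasDerivAt u (V (u t)) t) (huN : ∀ t ∈ Icc 0 B, u t ∈ N) (hyc : Continuous y)
    (hy : ∀ t, y t ∈ N → HasDerivAt y (V (y t)) t) (h0 : y 0 = u 0) : EqOn y u (Icc 0 B) := by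
  have huc : Continuous u := continuous_iff_continuousAt.2 fun t => (hu t).continuousAt
  refine IsClosed.Icc_subset_of_forall_exists_gt (s := {t | y t = u t}) ?_ h0 ?_
  · exact (isClosed_eq hyc huc).inter isClosed_Icc
  · rintro x ⟨hx, hxB⟩ z hz
    have hxN : y x ∈ N := by
      rw [show y x = u x from hx]
      exact huN x (Ico_subset_Icc_self hxB)
    have hev : ∀ᶠ t in 𝓝 x, y t ∈ N := hyc.continuousAt.eventually (hN.mem_nhds hxN)
    have heq : y =ᶠ[𝓝 x] u := ODE_solution_unique_of_eventually (v := fun _ => V)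
      (s := fun _ => univ) (.of_forall fun _ => hV.lipschitzOnWith)
      (by filter_upwards [hev] with t ht using ⟨hy t ht, mem_univ _⟩)
      (.of_forall fun t => ⟨hu t, mem_univ _⟩) hx
    obtain ⟨t, ht, ht'⟩ := ((heq.filter_mono nhdsWithin_le_nhds).and
      (Ioc_mem_nhdsGT hz)).exists
    exact ⟨t, ht, ht'⟩

end Uniqueness

/-! ### Nondegeneracy of the return displacement. -/

section Twist

variable {K₀ : ℝ × ℝ → ℝ} {R : (ℝ × ℝ) × ℝ × ℝ → ℝ} {X : ℝ → ℝ × ℝ → ℝ → ℝ × ℝ}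
  {G : ℝ → ℝ × ℝ → ℝ → ℝ}

/-- The Euclidean scalar product of the plane. -/
def dot (u v : ℝ × ℝ) : ℝ := u.1 * v.1 + u.2 * v.2

theorem dot_self_pos {v : ℝ × ℝ} (hv : v ≠ 0) : 0 < dot v v := by
  have : v.1 ≠ 0 ∨ v.2 ≠ 0 := by
    by_contra! h
    exact hv (Prod.ext h.1 h.2)
  unfold dot
  rcases this with h | h
  · nlinarith [mul_self_pos.2 h, mul_self_nonneg v.2]
  · nlinarith [mul_self_pos.2 h, mul_self_nonneg v.1]

theorem continuous_dot : Continuous fun p : (ℝ × ℝ) × (ℝ × ℝ) => dot p.1 p.2 := by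
  unfold dot
  fun_prop

theorem norm_sq_le_dot (v : ℝ × ℝ) : ‖v‖ ^ 2 ≤ dot v v := by
  rw [Prod.norm_def]
  rcases max_choice ‖v.1‖ ‖v.2‖ with h | h <;> rw [h, Real.norm_eq_abs, sq_abs] <;>
    unfold dot <;> nlinarith

/-- A vector orthogonal to the Hamiltonian vector field changes the Hamiltonian at full rate. -/
theorem norm_mul_norm_hamVec_le {A : ℝ × ℝ → ℝ} {x w : ℝ × ℝ} (h : dot w (hamVec A x) = 0) :
    ‖w‖ * ‖hamVec A x‖ ≤ |fderiv ℝ A x w| := by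
  have h3 : w = w.1 • ((1, 0) : ℝ × ℝ) + w.2 • ((0, 1) : ℝ × ℝ) := by
    ext <;> simp
  have h4 : fderiv ℝ A x w = w.1 * fderiv ℝ A x (1, 0) + w.2 * fderiv ℝ A x (0, 1) := by
    conv_lhs => rw [h3, map_add, map_smul, map_smul]
    simp
  simp only [dot, hamVec] at h
  set a := fderiv ℝ A x (1, 0)
  set b := fderiv ℝ A x (0, 1)
  have hsq : ∀ v : ℝ × ℝ, ‖v‖ ^ 2 ≤ v.1 ^ 2 + v.2 ^ 2 := by
    intro v
    have := norm_sq_le_dot v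
    unfold dot at this
    linarith
  refine abs_le_of_sq_le_sq' ?_ (abs_nonneg _) |>.2
  rw [sq_abs, h4, mul_pow]
  have h5 := hsq w
  have h6 := hsq (hamVec A x)
  simp only [hamVec] at h6 ⊢
  calc ‖w‖ ^ 2 * ‖(b, -a)‖ ^ 2 ≤ (w.1 ^ 2 + w.2 ^ 2) * (b ^ 2 + (-a) ^ 2) := by gcongr
    _ = (w.1 * a + w.2 * b) ^ 2 + (w.1 * b + w.2 * -a) ^ 2 := by ring
    _ = (w.1 * a + w.2 * b) ^ 2 := by rw [h]; ring

/-- The difference `y - c` is orthogonal to the field, hence parallel to the gradient at `y`, so `A`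
registers it at first order. -/
theorem isBigO_sub_of_dot_eq_zero {A : ℝ × ℝ → ℝ} (hA : ContDiff ℝ 1 A) {c : ℝ × ℝ}
    (hc : hamVec A c ≠ 0) {ι : Type*} {l : Filter ι} {y : ι → ℝ × ℝ} (hy : Tendsto y l (𝓝 c))
    (hperp : ∀ᶠ a in l, dot (y a - c) (hamVec A (y a)) = 0) :
    (fun a => y a - c) =O[l] fun a => A (y a) - A c := by
  have hV : Continuous (hamVec A) := (contDiff_hamVec (n := 0) (by simpa using hA)).continuous
  have hc0 : 0 < ‖hamVec A c‖ := norm_pos_iff.2 hc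
  set κ := ‖hamVec A c‖ with hκ
  have h1 : (fun a => A (y a) - A c - fderiv ℝ A c (y a - c)) =o[l] fun a => y a - c :=
    ((hA.differentiable one_ne_zero) c).hasFDerivAt.isLittleO.comp_tendsto hy
  have h2 : ∀ᶠ a in l, ‖fderiv ℝ A (y a) - fderiv ℝ A c‖ < κ / 8 := by
    have h3 : Continuous fun x => ‖fderiv ℝ A x - fderiv ℝ A c‖ :=
      ((hA.continuous_fderiv one_ne_zero).sub continuous_const).norm
    refine hy.eventually (h3.continuousAt.eventually_lt continuousAt_const ?_)
    simpa using (by positivity : 0 < κ / 8)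
  have h4 : ∀ᶠ a in l, κ / 2 < ‖hamVec A (y a)‖ :=
    hy.eventually (continuousAt_const.eventually_lt hV.norm.continuousAt (by linarith))
  -- The gradient term is at least `κ / 2 * ‖w‖`, and the two errors of `κ / 8 * ‖w‖` use up half of
  -- it.
  refine IsBigO.of_bound (4 / κ) ?_
  filter_upwards [h1.bound (show 0 < κ / 8 by positivity), h2, h4, hperp] with a b1 b2 b3 b4
  have b5 := norm_mul_norm_hamVec_le b4
  set w := y a - c
  have b6 : ‖w‖ * (κ / 2) ≤ ‖w‖ * ‖hamVec A (y a)‖ := by gcongr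
  have b7 : |fderiv ℝ A (y a) w - fderiv ℝ A c w| ≤ κ / 8 * ‖w‖ := by
    have := (fderiv ℝ A (y a) - fderiv ℝ A c).le_of_opNorm_le b2.le w
    simpa using this
  rw [Real.norm_eq_abs] at b1 ⊢
  have b8 : |fderiv ℝ A (y a) w| ≤ |A (y a) - A c| + κ / 4 * ‖w‖ := by
    have e : fderiv ℝ A (y a) w = (fderiv ℝ A (y a) w - fderiv ℝ A c w) -
      (A (y a) - A c - fderiv ℝ A c w) + (A (y a) - A c) := by ring
    rw [e]
    refine (abs_add_le _ _).trans ?_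
    have := abs_sub (fderiv ℝ A (y a) w - fderiv ℝ A c w) (A (y a) - A c - fderiv ℝ A c w)
    linarith
  rw [div_mul_eq_mul_div, le_div_iff₀ hc0]
  linarith

theorem IsModelFlow.tendsto_inv_smul_sub (h : IsModelFlow K₀ R X G) {c : ℝ × ℝ} {ι : Type*}
    {l : Filter ι} {y : ι → ℝ × ℝ} {d : ι → ℝ} (hy : Tendsto y l (𝓝 c)) (hd : Tendsto d l (𝓝 0))
    (hd0 : ∀ᶠ a in l, d a ≠ 0) :
    Tendsto (fun a => (d a)⁻¹ • (X (d a) (y a) 0 - y a)) l (𝓝 (hamVec K₀ c)) := by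
  obtain ⟨L, hL⟩ := h.lipschitz_unperturbed
  rw [Metric.tendsto_nhds]
  intro η hη
  have hcont : Continuous fun p : ℝ × (ℝ × ℝ) => hamVec K₀ (X p.1 p.2 0) - hamVec K₀ c :=
    (hL.continuous.comp (h.continuous.comp (f := fun p : ℝ × (ℝ × ℝ) => (p.1, p.2, (0 : ℝ)))
      (by fun_prop))).sub continuous_const
  have hev : ∀ᶠ p : ℝ × (ℝ × ℝ) in 𝓝 (0, c), ‖hamVec K₀ (X p.1 p.2 0) - hamVec K₀ c‖ < η / 2 := by
    refine hcont.norm.continuousAt.eventually_lt continuousAt_const ?_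
    simpa [h.zero] using hη
  rw [nhds_prod_eq] at hev
  obtain ⟨s, hs, t, ht, hst⟩ := mem_prod_iff.1 hev
  obtain ⟨r, hr, hrs⟩ := Metric.mem_nhds_iff.1 hs
  filter_upwards [hy ht, hd (Metric.ball_mem_nhds 0 hr), hd0] with a ha1 ha2 ha3
  have hmv := Convex.norm_image_sub_le_of_norm_hasDerivWithin_le (𝕜 := ℝ)
    (f := fun τ => X τ (y a) 0 - τ • hamVec K₀ c)
    (f' := fun τ => hamVec K₀ (X τ (y a) 0) - hamVec K₀ c) (s := Metric.ball 0 r) (C := η / 2)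
    (x := 0) (y := d a) (fun τ _ => by
      have := (h.hasDerivAt_unperturbed (y a) τ).sub ((hasDerivAt_id τ).smul_const (hamVec K₀ c))
      simp only [one_smul] at this
      exact this.hasDerivWithinAt)
    (fun τ hτ => (hst (show (τ, y a) ∈ s ×ˢ t from ⟨hrs hτ, ha1⟩)).le)
    (convex_ball _ _) (Metric.mem_ball_self hr) ha2
  simp only [h.zero, zero_smul, sub_zero] at hmv
  rw [dist_eq_norm]
  have e : (d a)⁻¹ • (X (d a) (y a) 0 - y a) - hamVec K₀ c =
      (d a)⁻¹ • (X (d a) (y a) 0 - d a • hamVec K₀ c - y a) := by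
    rw [sub_right_comm, smul_sub _ (X (d a) (y a) 0 - y a), smul_smul, inv_mul_cancel₀ ha3, one_smul]
  rw [e, norm_smul, norm_inv]
  have hda : 0 < ‖d a‖ := norm_pos_iff.2 ha3
  calc ‖d a‖⁻¹ * ‖X (d a) (y a) 0 - d a • hamVec K₀ c - y a‖ ≤ ‖d a‖⁻¹ * (η / 2 * ‖d a‖) := by gcongr
    _ = η / 2 := by field_simp
    _ < η := by linarith

/-- If points `y a → c` are displaced along the flow during time `t` by a small time `-d a` that
controls their energy difference to `c`, then the displacement has a nonzero derivative at `c`. -/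
theorem IsModelFlow.displacement_deriv_ne_zero (h : IsModelFlow K₀ R X G) (hK₀ : ContDiff ℝ 1 K₀)
    {c : ℝ × ℝ} (hc : hamVec K₀ c ≠ 0) {t : ℝ} (hct : X t c 0 = c)
    {s' : ℝ × ℝ →L[ℝ] ℝ} (hs : HasFDerivAt (fun x => dot (X t x 0 - x) (hamVec K₀ x)) s' c)
    {ι : Type*} {l : Filter ι} [l.NeBot] {y : ι → ℝ × ℝ} {d : ι → ℝ} (hy : Tendsto y l (𝓝 c))
    (hperp : ∀ᶠ a in l, dot (y a - c) (hamVec K₀ (y a)) = 0)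
    (hd : Tendsto d l (𝓝 0)) (hd0 : ∀ᶠ a in l, d a ≠ 0)
    (hX : ∀ᶠ a in l, X t (y a) 0 = X (-d a) (y a) 0)
    (hE : (fun a => K₀ (y a) - K₀ c) =O[l] d) : s' ≠ 0 := by
  rintro rfl
  have hV : Continuous (hamVec K₀) := (contDiff_hamVec (n := 0) (by simpa using hK₀)).continuous
  -- With zero derivative the projected displacement is `o(y - c)`, hence `o(d)`. But divided by
  -- `-d` it tends to the squared length of `hamVec K₀ c`, which is positive.
  have h1 := (hs.isLittleO.comp_tendsto hy).trans_isBigO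
    ((isBigO_sub_of_dot_eq_zero hK₀ hc hy hperp).trans hE)
  have h2 := h1.tendsto_div_nhds_zero
  have h3 := h.tendsto_inv_smul_sub hy (d := fun a => -d a) (by simpa using hd.neg)
    (hd0.mono fun a ha => neg_ne_zero.2 ha)
  have h4 : Tendsto (fun a => dot ((-d a)⁻¹ • (X (-d a) (y a) 0 - y a)) (hamVec K₀ (y a))) l
      (𝓝 (dot (hamVec K₀ c) (hamVec K₀ c))) :=
    (continuous_dot.tendsto (hamVec K₀ c, hamVec K₀ c)).comp
      (h3.prodMk_nhds ((hV.tendsto c).comp hy))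
  have h5 : Tendsto (fun a => dot ((-d a)⁻¹ • (X (-d a) (y a) 0 - y a)) (hamVec K₀ (y a))) l
      (𝓝 0) := by
    have h6 := h2.neg
    rw [neg_zero] at h6
    refine h6.congr' ?_
    filter_upwards [hX] with a ha
    simp only [Function.comp, zero_apply, hct, sub_self, ha]
    simp only [dot, Prod.smul_fst, Prod.smul_snd, smul_eq_mul, Prod.fst_zero, Prod.snd_zero, inv_neg]
    ring
  exact (dot_self_pos hc).ne' (tendsto_nhds_unique h4 h5)

end Twist

theorem isBigO_sub_of_hasDerivAt {f : ℝ → ℝ} {f' x : ℝ} (hf : HasDerivAt f f' x) (hf' : f' ≠ 0)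
    {ι : Type*} {l : Filter ι} {u : ι → ℝ} (hu : Tendsto u l (𝓝 x)) :
    (fun a => u a - x) =O[l] fun a => f (u a) - f x := by
  have h1 := (HasDerivAtFilter.isTheta_sub hf hf').isBigO_symm
  exact h1.comp_tendsto (hu.prodMk (tendsto_pure.2 (.of_forall fun _ => rfl)))

/-! ### The family of unperturbed periodic orbits and the twist condition. -/

section Family

variable {F : ℝ × ℝ → ℝ} {G₀ : ℝ → ℝ} {K₁ : ℝ × ℝ → ℝ → ℝ → ℝ} {D : Set (ℝ × ℝ)}
  {I₀ μ ε₁ h : ℝ} {H : ℝ × ℝ → ℝ → ℝ → ℝ} {K₀ : ℝ × ℝ → ℝ} {R : (ℝ × ℝ) × ℝ × ℝ → ℝ}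
  {N : Set (ℝ × ℝ)} {δ : ℝ} {X : ℝ → ℝ × ℝ → ℝ → ℝ × ℝ} {G : ℝ → ℝ × ℝ → ℝ → ℝ}
  {q : ℝ → ℝ → ℝ × ℝ} {T : ℝ → ℝ} {hα : ℝ}

theorem IsSolution.continuous {ε : ℝ} {x : ℝ → ℝ × ℝ} (hx : IsSolution H D ε x) : Continuous x :=
  continuous_iff_continuousAt.2 fun t => (hx t).2.continuousAt

/-- Solutions of the reduced system that stay in `N` are trajectories of the model flow. -/
theorem IsSolution.eq_flow {ε : ℝ} {x : ℝ → ℝ × ℝ} (hx : IsSolution H D ε x)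
    (hmod : IsLocalModel H K₀ R N δ) (hflow : IsModelFlow K₀ R X G) (hε : |ε| < δ)
    (hN : ∀ t, x t ∈ N) (t : ℝ) : x t = X t (x 0) ε :=
  hflow.eq_flow (fun t => by
    rw [← hmod.hamVec_eq (hN t) t hε]
    exact (hx t).2) t

variable (hq : IsPeriodicFamily H D F hα q T) (hmod : IsLocalModel H K₀ R N δ)
  (hflow : IsModelFlow K₀ R X G) (hC : ∀ t, q hα t ∈ N)

include hq hmod hflow hC

theorem resonant_eq_flow (t : ℝ) : q hα t = X t (q hα 0) 0 :=
  hq.1.self_of_nhds.1.eq_flow hmod hflow (by simpa using hmod.pos) hC t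

theorem resonant_add_eq_flow (s t : ℝ) : q hα (s + t) = X s (q hα t) 0 := by
  rw [resonant_eq_flow hq hmod hflow hC (s + t), resonant_eq_flow hq hmod hflow hC t,
    hflow.add_unperturbed]

/-- An equilibrium on the orbit would make it constant, and a constant has no least positive period.
-/
theorem hamVec_resonant_ne_zero (t : ℝ) : hamVec K₀ (q hα t) ≠ 0 := by
  intro h0
  have h1 : ∀ s, q hα t = X s (q hα t) 0 := fun s =>
    hflow.eq_flow (ε := 0) (y := fun _ => q hα t) (fun s => by
      rw [IsModelFlow.modelVec_unperturbed, h0]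
      exact hasDerivAt_const _ _) s
  have h2 : ∀ s, q hα s = q hα t := fun s => by
    have := resonant_add_eq_flow hq hmod hflow hC (s - t) t
    rw [sub_add_cancel] at this
    rw [this, ← h1]
  obtain ⟨hT, -, hmin⟩ := hq.1.self_of_nhds.2.2
  exact hmin (T hα / 2) (by linarith) (by linarith) fun s => by rw [h2, h2 s]

/-- Neighbouring orbits are not known to stay in `N`, but over a bounded time the model trajectories
do, by continuity in the starting point; `eqOn_of_mem_open` identifies the two. -/
theorem family_eq_flow (B : ℝ) :
    ∀ᶠ a in 𝓝 hα, ∀ t ∈ Icc 0 B, q a t = X t (q a 0) 0 := by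
  obtain ⟨L, hL⟩ := hflow.lipschitz_unperturbed
  have h1 : ∀ᶠ x in 𝓝 (q hα 0), ∀ t ∈ Icc 0 B, X t x 0 ∈ N := by
    refine isCompact_Icc.eventually_forall_of_forall_eventually fun t _ => ?_
    have hcont : Continuous fun p : (ℝ × ℝ) × ℝ => X p.2 p.1 0 :=
      hflow.continuous.comp (f := fun p : (ℝ × ℝ) × ℝ => (p.2, p.1, (0 : ℝ))) (by fun_prop)
    refine hcont.continuousAt.eventually (hmod.isOpen.mem_nhds ?_)
    simp only
    rw [← resonant_eq_flow hq hmod hflow hC]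
    exact hC t
  filter_upwards [hq.1, hq.2.eventually h1] with a ha haN
  refine eqOn_of_mem_open hL hmod.isOpen (fun t => hflow.hasDerivAt_unperturbed (q a 0) t) haN
    ha.1.continuous (fun t ht => ?_) (hflow.zero _ _).symm
  have := (ha.1 t).2
  rwa [hmod.hamVec_eq ht t (by simpa using hmod.pos), IsModelFlow.modelVec_unperturbed] at this

theorem family_add_eq_flow (B : ℝ) : ∀ᶠ a in 𝓝 hα, ∀ s ∈ Icc 0 B, ∀ t, s + t ∈ Icc 0 B →
    q a (s + t) = X t (q a s) 0 := by
  filter_upwards [family_eq_flow hq hmod hflow hC B] with a ha s hs t hst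
  rw [ha s hs, ha _ hst, add_comm s t, hflow.add_unperturbed]

omit hflow in
/-- The energy difference to a point of the resonant orbit is controlled by the label. -/
theorem isBigO_energy_sub (hε₁ : 0 < ε₁) (hK : IsTwoDofHamiltonian F G₀ K₁ D I₀ μ)
    (hH : IsReducedHamiltonian F G₀ K₁ D I₀ μ ε₁ h H) (hND : N ⊆ D) (s : ℝ)
    {ι : Type*} {l : Filter ι} {a : ι → ℝ} {y : ι → ℝ × ℝ} (hy : Tendsto y l (𝓝 (q hα s)))
    (hF : ∀ᶠ i in l, F (y i) = a i) :
    (fun i => K₀ (y i) - K₀ (q hα s)) =O[l] fun i => a i - hα := by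
  have h0 : (0 : ℝ) ∈ Ioo (-ε₁) ε₁ := by constructor <;> linarith
  -- The isoenergy relation ties `K₀` to the label `F`; as `G₀'` is nonzero, it can be inverted to
  -- first order.
  have hiso : ∀ x ∈ N, G₀ (-K₀ x) = h - F x := by
    intro x hx
    have := hH.isoenergy x (hND hx) 0 0 h0
    have h1 := hmod.H₀_eq hx
    rw [H₀] at h1
    rw [h1] at this
    linarith
  have hc := hC s
  have hder : HasDerivAt G₀ (deriv G₀ (-K₀ (q hα s))) (-K₀ (q hα s)) := by
    rw [← hmod.H₀_eq hc]
    exact (hK.analytic_G _ (hH.action_mem _ (hND hc) 0 0 h0)).differentiableAt.hasDerivAt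
  have hne : deriv G₀ (-K₀ (q hα s)) ≠ 0 := by
    rw [← hmod.H₀_eq hc]
    exact hH.frequency_ne_zero _ (hND hc) 0
  have hlim : Tendsto (fun i => -K₀ (y i)) l (𝓝 (-K₀ (q hα s))) :=
    ((hmod.smooth_K₀.continuous.tendsto _).comp hy).neg
  have h1 := isBigO_sub_of_hasDerivAt hder hne hlim
  have h2 : (fun i => G₀ (-K₀ (y i)) - G₀ (-K₀ (q hα s))) =ᶠ[l] fun i => -(a i - hα) := by
    filter_upwards [hF, hy.eventually (hmod.isOpen.mem_nhds hc)] with i hi hiN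
    rw [hiso _ hiN, hiso _ hc, hi, hq.1.self_of_nhds.2.1 s]
    ring
  have h3 := (h1.congr' .rfl h2).neg_right.neg_left
  simp only [neg_neg] at h3
  refine h3.congr_left fun i => ?_
  ring

omit hmod hflow hC in
-- A closest point makes the difference orthogonal to the orbit. Its time is taken from the second
-- turn, so that a small step back still has positive time.
theorem exists_closest (s : ℝ) : ∃ σ : ℝ → ℝ,
    ∀ᶠ a in 𝓝 hα, σ a ∈ Icc (T a) (2 * T a) ∧
      (∀ t, dot (q a (σ a) - q hα s) (q a (σ a) - q hα s) ≤
        dot (q a t - q hα s) (q a t - q hα s)) := by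
  have key : ∀ᶠ a in 𝓝 hα, ∃ r, r ∈ Icc (T a) (2 * T a) ∧
      (∀ t, dot (q a r - q hα s) (q a r - q hα s) ≤ dot (q a t - q hα s) (q a t - q hα s)) := by
    filter_upwards [hq.1] with a ha
    obtain ⟨hT, hper, -⟩ := ha.2.2
    have hcont : Continuous fun t => dot (q a t - q hα s) (q a t - q hα s) :=
      continuous_dot.comp ((ha.1.continuous.sub continuous_const).prodMk
        (ha.1.continuous.sub continuous_const))
    obtain ⟨r, hr, hmin⟩ := isCompact_Icc.exists_isMinOn (s := Icc (T a) (2 * T a))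
      (nonempty_Icc.2 (by linarith)) hcont.continuousOn
    refine ⟨r, hr, fun t => ?_⟩
    obtain ⟨t', ht', htt'⟩ := hper.exists_mem_Ico hT t (T a)
    rw [htt']
    exact hmin ⟨ht'.1, by linarith [ht'.2]⟩
  exact ⟨fun a => Classical.epsilon fun r => r ∈ Icc (T a) (2 * T a) ∧
      (∀ t, dot (q a r - q hα s) (q a r - q hα s) ≤ dot (q a t - q hα s) (q a t - q hα s)),
    key.mono fun a ha => Classical.epsilon_spec ha⟩

/-- The twist condition: the first return along the resonant orbit is nondegenerate. -/
theorem twist_deriv_ne_zero (hε₁ : 0 < ε₁) (hK : IsTwoDofHamiltonian F G₀ K₁ D I₀ μ)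
    (hH : IsReducedHamiltonian F G₀ K₁ D I₀ μ ε₁ h H) (hND : N ⊆ D) {n : ℕ} (hn : 0 < n)
    (htwist : deriv T hα ≠ 0) (s : ℝ) {s' : ℝ × ℝ →L[ℝ] ℝ}
    (hs : HasFDerivAt (fun x => dot (X (n * T hα) x 0 - x) (hamVec K₀ x)) s' (q hα s)) :
    s' ≠ 0 := by
  obtain ⟨hT0, hper0, -⟩ := hq.1.self_of_nhds.2.2
  wlog hsT : s ∈ Ico 0 (T hα) generalizing s
  · obtain ⟨s₁, hs₁, hss₁⟩ := hper0.exists_mem_Ico₀ hT0 s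
    rw [hss₁] at hs
    exact this s₁ hs hs₁
  have hTd : HasDerivAt T (deriv T hα) hα := (differentiableAt_of_deriv_ne_zero htwist).hasDerivAt
  have hTc : ContinuousAt T hα := hTd.continuousAt
  have hn0 : (n : ℝ) ≠ 0 := by exact_mod_cast hn.ne'
  obtain ⟨σ, hσ⟩ := exists_closest hq s
  set L := n * T hα with hL
  have hL0 : 0 ≤ L := by positivity
  -- An upper bound for `σ a + L` and `σ a - d a`, given `σ a ≤ 2 * T a`, `T a < T hα + 1` and `|d
  -- a| < 1`.
  set B := 2 * (T hα + 1) + L + 1 with hB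
  set y : ℝ → ℝ × ℝ := fun a => q a (σ a) with hy
  -- On `q a`, `n` full turns take time `L + d a`, so flowing for time `L` amounts to flowing for
  -- time `-d a`.
  set d : ℝ → ℝ := fun a => n * T a - L with hd
  have hadd := family_add_eq_flow hq hmod hflow hC B
  have hTlt : ∀ᶠ a in 𝓝 hα, T a < T hα + 1 :=
    hTc.eventually_lt continuousAt_const (by linarith)
  have hTgt : ∀ᶠ a in 𝓝 hα, T hα / 2 < T a :=
    continuousAt_const.eventually_lt hTc (by linarith)
  have hdlim : Tendsto d (𝓝 hα) (𝓝 0) := by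
    have : Tendsto d (𝓝 hα) (𝓝 (n * T hα - L)) := (hTc.tendsto.const_mul _).sub_const _
    simpa [hL] using this
  have hqs : Tendsto (fun a => q a s) (𝓝 hα) (𝓝 (q hα s)) := by
    have hcont : Continuous fun x => X s x 0 :=
      hflow.continuous.comp (f := fun x : ℝ × ℝ => (s, x, (0 : ℝ))) (by fun_prop)
    have h1 := (hcont.tendsto (q hα 0)).comp hq.2.tendsto
    simp only [← resonant_eq_flow hq hmod hflow hC] at h1
    refine h1.congr' ?_
    filter_upwards [family_eq_flow hq hmod hflow hC (T hα)] with a ha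
    exact (ha s (Ico_subset_Icc_self hsT)).symm
  have hylim : Tendsto y (𝓝 hα) (𝓝 (q hα s)) := by
    rw [tendsto_iff_norm_sub_tendsto_zero]
    -- The closest point is no farther away than `q a s`, which converges.
    have h1 : Tendsto (fun a => Real.sqrt (dot (q a s - q hα s) (q a s - q hα s))) (𝓝 hα) (𝓝 0) := by
      have h2 : Continuous fun v : ℝ × ℝ => Real.sqrt (dot (v - q hα s) (v - q hα s)) :=
        Real.continuous_sqrt.comp (continuous_dot.comp
          ((continuous_id.sub continuous_const).prodMk (continuous_id.sub continuous_const)))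
      simpa [dot, Function.comp_def] using (h2.tendsto (q hα s)).comp hqs
    refine squeeze_zero' (.of_forall fun _ => norm_nonneg _) ?_ h1
    filter_upwards [hσ] with a ha
    exact Real.le_sqrt_of_sq_le ((norm_sq_le_dot _).trans (ha.2 s))
  have hyN : ∀ᶠ a in 𝓝 hα, y a ∈ N := hylim.eventually (hmod.isOpen.mem_nhds (hC s))
  have hne : 𝓝[≠] hα ≤ 𝓝 hα := nhdsWithin_le_nhds
  refine hflow.displacement_deriv_ne_zero (hmod.smooth_K₀.of_le (by norm_cast))
    (hamVec_resonant_ne_zero hq hmod hflow hC s) (t := L) ?_ hs (l := 𝓝[≠] hα) (y := y) (d := d)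
    (hylim.mono_left hne) (Eventually.filter_mono hne ?_) (hdlim.mono_left hne) ?_
    (Eventually.filter_mono hne ?_) ?_
  · rw [← resonant_add_eq_flow hq hmod hflow hC, add_comm]
    exact hper0.nat_mul n s
  · filter_upwards [hσ, hyN, hq.1] with a ha haN haq
    have h1 := (haq.1 (σ a)).2
    rw [hmod.hamVec_eq haN _ (by simpa using hmod.pos), IsModelFlow.modelVec_unperturbed] at h1
    have h2 := h1.sub_const (q hα s)
    have h2a : HasDerivAt (fun t => (q a t - q hα s).1) (hamVec K₀ (y a)).1 (σ a) := h2.fst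
    have h2b : HasDerivAt (fun t => (q a t - q hα s).2) (hamVec K₀ (y a)).2 (σ a) := h2.snd
    have h3 := (h2a.mul h2a).add (h2b.mul h2b)
    have h4 := IsLocalMin.hasDerivAt_eq_zero (a := σ a)
      (f := fun t => dot (q a t - q hα s) (q a t - q hα s)) (.of_forall ha.2) h3
    unfold dot
    simp only [hy, Prod.fst_sub, Prod.snd_sub] at h4 ⊢
    linarith
  · have h1 := hTd.eventually_ne htwist (c := T hα)
    filter_upwards [h1] with a ha
    rw [hd, hL]
    simp only
    rw [← mul_sub]
    exact mul_ne_zero hn0 (sub_ne_zero.2 ha)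
  · have hdsmall : ∀ᶠ a in 𝓝 hα, |d a| < min (T hα / 2) 1 := by
      have := hdlim (Metric.ball_mem_nhds 0 (show 0 < min (T hα / 2) 1 by positivity))
      filter_upwards [this] with a ha
      simpa using ha
    filter_upwards [hσ, hadd, hTlt, hTgt, hdsmall, hq.1] with a ha1 ha2 ha3 ha4 ha5 ha6
    have b1 := abs_lt.1 (ha5.trans_le (min_le_left _ _))
    have b2 := abs_lt.1 (ha5.trans_le (min_le_right _ _))
    have hσB : σ a ∈ Icc 0 B := ⟨by linarith [ha1.1.1], by linarith [ha1.1.2]⟩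
    simp only [hy]
    rw [← ha2 _ hσB L ⟨by linarith [ha1.1.1], by linarith [ha1.1.2]⟩,
      ← ha2 _ hσB (-d a) ⟨by linarith [ha1.1.1], by linarith [ha1.1.2]⟩]
    have := (ha6.2.2.2.1.nat_mul n) (σ a + -d a)
    rw [← this]
    congr 1
    simp only [hd]
    ring
  · have h1 := isBigO_energy_sub hq hmod hC hε₁ hK hH hND s (l := 𝓝[≠] hα) (y := y)
      (a := fun a => a) (hylim.mono_left hne)
      (Eventually.filter_mono hne (by filter_upwards [hq.1] with a ha using ha.2.1 _))
    refine h1.trans ?_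
    -- Here the twist enters quantitatively: the label difference is bounded by the period
    -- difference, hence by `d`.
    have h2 := isBigO_sub_of_hasDerivAt hTd htwist (u := fun a => a) (l := 𝓝[≠] hα) hne
    refine h2.trans (IsBigO.of_bound 1 (.of_forall fun a => ?_))
    simp only [hd, hL]
    rw [← mul_sub, norm_mul, one_mul]
    have : (1 : ℝ) ≤ ‖(n : ℝ)‖ := by
      rw [Real.norm_eq_abs, Nat.abs_cast]
      exact_mod_cast hn
    nlinarith [norm_nonneg (T a - T hα)]

end Family

/-! ### From returning points to orbits in the extended phase space. -/

section OrbitCount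

theorem coe_add_two_pi_mul (t : ℝ) (l : ℕ) :
    ((t + 2 * Real.pi * l : ℝ) : AddCircle (2 * Real.pi)) = t := by
  rw [mul_comm (2 * Real.pi) (l : ℝ), ← nsmul_eq_mul, AddCircle.coe_add, AddCircle.coe_nsmul,
    AddCircle.coe_period, smul_zero, add_zero]

theorem extOrbit_add_two_pi_mul (x : ℝ → ℝ × ℝ) (l : ℕ) :
    extOrbit (fun t => x (t + 2 * Real.pi * l)) = extOrbit x := by
  have h := fun t : ℝ => coe_add_two_pi_mul t l
  unfold extOrbit
  ext p
  constructor
  · rintro ⟨t, rfl⟩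
    exact ⟨t + 2 * Real.pi * l, by simp only [h]⟩
  · rintro ⟨t, rfl⟩
    refine ⟨t - 2 * Real.pi * l, ?_⟩
    have := h (t - 2 * Real.pi * l)
    rw [sub_add_cancel] at this
    simp only [sub_add_cancel, this]

/-- If the time-`2π` map permutes a set of `j` points freely in cycles of length `m`, then the
orbits of these points number `j / m`. -/
theorem encard_orbits_mul {e : ℝ → ℝ × ℝ → ℝ × ℝ} {P : Set (ℝ × ℝ)} {m j : ℕ} (hm : 0 < m)
    (hP : P.encard = j) (h0 : ∀ p, e 0 p = p)
    (hadd : ∀ t p (l : ℕ), e (t + 2 * Real.pi * l) p = e t (e (2 * Real.pi * l) p))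
    (hmap : ∀ p ∈ P, ∀ l : ℕ, e (2 * Real.pi * l) p ∈ P)
    (hper : ∀ p ∈ P, Function.Periodic (fun t => e t p) (2 * Real.pi * m))
    (hfree : ∀ p ∈ P, ∀ l : ℕ, 0 < l → l < m → e (2 * Real.pi * l) p ≠ p) :
    ((fun p => extOrbit fun t => e t p) '' P).encard * m = j := by
  classical
  have hfin : P.Finite := finite_of_encard_eq_coe hP
  obtain ⟨s, rfl⟩ := hfin.exists_finset_coe
  rw [encard_coe_eq_coe_finsetCard] at hP
  have hP' : s.card = j := by exact_mod_cast hP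
  set f : ℝ × ℝ → Set ExtPhase := fun p => extOrbit fun t => e t p with hf
  rw [← Finset.coe_image, encard_coe_eq_coe_finsetCard]
  -- An orbit meets the section `φ = 0` exactly in the `m` distinct iterates of one of its points.
  have hfiber : ∀ b ∈ s.image f, (s.filter fun a => f a = b).card = m := by
    intro b hb
    obtain ⟨p, hp, rfl⟩ := Finset.mem_image.1 hb
    have hset : (s.filter fun a => f a = f p) =
        (Finset.range m).image fun l : ℕ => e (2 * Real.pi * l) p := by
      ext a
      simp only [Finset.mem_filter, Finset.mem_image, Finset.mem_range]
      constructor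
      · rintro ⟨ha, hap⟩
        have h1 : (a, (0 : AddCircle (2 * Real.pi))) ∈ f p := by
          rw [← hap]
          exact ⟨0, by simp [h0]⟩
        obtain ⟨t, ht⟩ := h1
        simp only [Prod.mk.injEq] at ht
        obtain ⟨z, hz⟩ := (AddCircle.coe_eq_zero_iff _).1 ht.2
        have hm' : (0 : ℤ) < m := by exact_mod_cast hm
        -- The orbit meets the section at time `2πz`; the period `2πm` allows `z` to be reduced
        -- modulo `m`.
        refine ⟨(z % m).toNat, ?_, ?_⟩
        · have := Int.emod_lt_of_pos z hm'
          have := Int.emod_nonneg z hm'.ne'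
          omega
        · rw [← ht.1, ← hz]
          have h2 : ((z % m).toNat : ℝ) = (z : ℝ) - m * ((z / m : ℤ) : ℝ) := by
            have h3 : ((z % m).toNat : ℤ) = z % m := Int.toNat_of_nonneg (Int.emod_nonneg z hm'.ne')
            have h4 : (((z % m).toNat : ℤ) : ℝ) = ((z - m * (z / m) : ℤ) : ℝ) := by
              rw [h3, Int.emod_def]
            exact_mod_cast h4
          have h5 := ((hper p hp).int_mul (z / m)) (2 * Real.pi * (z % m).toNat)
          rw [← h5]
          congr 1
          rw [h2, zsmul_eq_mul]
          ring
      · rintro ⟨l, -, rfl⟩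
        refine ⟨hmap p hp l, ?_⟩
        simp only [hf, ← hadd]
        exact extOrbit_add_two_pi_mul (fun t => e t p) l
    rw [hset, Finset.card_image_of_injOn, Finset.card_range]
    have hlt : ∀ a b : ℕ, a < b → b < m → e (2 * Real.pi * a) p ≠ e (2 * Real.pi * b) p := by
      intro a b hab hbm heq
      refine hfree _ (hmap p hp a) (b - a) (by omega) (by omega) ?_
      rw [← hadd, heq]
      congr 1
      rw [Nat.cast_sub hab.le]
      ring
    intro a ha b hb hab
    simp only [Finset.coe_range, mem_Iio] at ha hb
    rcases lt_trichotomy a b with h | h | h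
    · exact absurd hab (hlt a b h hb)
    · exact h
    · exact absurd hab.symm (hlt b a h ha)
  have := Finset.card_eq_sum_card_image f s
  rw [Finset.sum_congr rfl hfiber, Finset.sum_const, smul_eq_mul, hP'] at this
  rw [this]
  push_cast
  rfl

end OrbitCount

/-! ### Local rigidity on energy levels and a planar linear algebra fact. -/

section Local

/-- Orthogonally to its Hamiltonian field `A` changes at full rate, so two nearby points on one
level cannot differ in that direction. Strict differentiability makes this uniform in both points.
-/
theorem eventually_eq_of_dot_eq_zero {A : ℝ × ℝ → ℝ} (hA : ContDiff ℝ 1 A) {c : ℝ × ℝ}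
    (hc : hamVec A c ≠ 0) : ∀ᶠ p : (ℝ × ℝ) × (ℝ × ℝ) in 𝓝 (c, c),
      A p.1 = A p.2 → dot (p.1 - p.2) (hamVec A p.2) = 0 → p.1 = p.2 := by
  have hV : Continuous (hamVec A) := (contDiff_hamVec (n := 0) (by simpa using hA)).continuous
  have hc0 : 0 < ‖hamVec A c‖ := norm_pos_iff.2 hc
  set κ := ‖hamVec A c‖ with hκ
  have h1 := (hA.contDiffAt.hasStrictFDerivAt (x := c) one_ne_zero).isLittleO.bound
    (show 0 < κ / 8 by positivity)
  have h2 : ∀ᶠ p : (ℝ × ℝ) × (ℝ × ℝ) in 𝓝 (c, c), ‖fderiv ℝ A p.2 - fderiv ℝ A c‖ < κ / 8 := by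
    have h3 : Continuous fun p : (ℝ × ℝ) × (ℝ × ℝ) => ‖fderiv ℝ A p.2 - fderiv ℝ A c‖ :=
      (((hA.continuous_fderiv one_ne_zero).comp continuous_snd).sub continuous_const).norm
    refine h3.continuousAt.eventually_lt continuousAt_const ?_
    simpa using (by positivity : 0 < κ / 8)
  have h4 : ∀ᶠ p : (ℝ × ℝ) × (ℝ × ℝ) in 𝓝 (c, c), κ / 2 < ‖hamVec A p.2‖ :=
    continuousAt_const.eventually_lt (hV.comp continuous_snd).norm.continuousAt
      (show κ / 2 < ‖hamVec A c‖ by linarith)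
  filter_upwards [h1, h2, h4] with p b1 b2 b3 b0 b4
  have b5 := norm_mul_norm_hamVec_le b4
  rw [b0, sub_self, zero_sub, norm_neg, Real.norm_eq_abs] at b1
  set w := p.1 - p.2 with hw
  have b6 : ‖w‖ * (κ / 2) ≤ ‖w‖ * ‖hamVec A p.2‖ := by gcongr
  have b7 : |fderiv ℝ A p.2 w - fderiv ℝ A c w| ≤ κ / 8 * ‖w‖ := by
    have := (fderiv ℝ A p.2 - fderiv ℝ A c).le_of_opNorm_le b2.le w
    simpa using this
  have b8 := abs_sub_abs_le_abs_sub (fderiv ℝ A p.2 w) (fderiv ℝ A c w)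
  have b9 : ‖w‖ * κ ≤ 0 := by nlinarith
  have b10 : ‖w‖ = 0 := le_antisymm (by
    by_contra! h
    nlinarith [mul_pos h hc0]) (norm_nonneg _)
  exact sub_eq_zero.1 (norm_eq_zero.1 b10)

/-- The vector `v` shows the two forms to be independent, so in the plane their common kernel is
trivial. -/
theorem eq_zero_of_linear_forms {a b : ℝ × ℝ →L[ℝ] ℝ} {v w : ℝ × ℝ} (ha : a ≠ 0) (hav : a v = 0)
    (hbv : b v ≠ 0) (haw : a w = 0) (hbw : b w = 0) : w = 0 := by
  have h3 : ∀ (c : ℝ × ℝ →L[ℝ] ℝ) (u : ℝ × ℝ), c u = u.1 * c (1, 0) + u.2 * c (0, 1) := by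
    intro c u
    have : u = u.1 • ((1, 0) : ℝ × ℝ) + u.2 • ((0, 1) : ℝ × ℝ) := by ext <;> simp
    conv_lhs => rw [this, map_add, map_smul, map_smul]
    simp
  rw [h3] at hav hbv haw hbw
  have ha' : a (1, 0) ≠ 0 ∨ a (0, 1) ≠ 0 := by
    by_contra! h
    exact ha (ContinuousLinearMap.ext fun u => by rw [h3, h.1, h.2]; simp)
  set a1 := a (1, 0)
  set a2 := a (0, 1)
  set b1 := b (1, 0)
  set b2 := b (0, 1)
  have hdet : w.1 * v.2 - w.2 * v.1 = 0 := by
    rcases ha' with h | h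
    · apply mul_left_cancel₀ h
      linear_combination v.2 * haw - w.2 * hav
    · apply mul_left_cancel₀ h
      linear_combination w.1 * hav - v.1 * haw
  ext
  · apply mul_right_cancel₀ hbv
    simp only [Prod.fst_zero]
    linear_combination v.1 * hbw + b2 * hdet
  · apply mul_right_cancel₀ hbv
    simp only [Prod.snd_zero]
    linear_combination v.2 * hbw - b1 * hdet

end Local

/-! ### The Mel'nikov function and the bifurcation map on the resonant orbit. -/

section Resonance

variable {H : ℝ × ℝ → ℝ → ℝ → ℝ} {D : Set (ℝ × ℝ)} {F : ℝ × ℝ → ℝ}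
  {K₀ : ℝ × ℝ → ℝ} {R : (ℝ × ℝ) × ℝ × ℝ → ℝ}
  {N : Set (ℝ × ℝ)} {δ : ℝ} {X : ℝ → ℝ × ℝ → ℝ → ℝ × ℝ} {G : ℝ → ℝ × ℝ → ℝ → ℝ}
  {q : ℝ → ℝ → ℝ × ℝ} {T : ℝ → ℝ} {hα : ℝ}

theorem IsModelFlow.add_two_pi_mul (hflow : IsModelFlow K₀ R X G)
    (hper : ∀ x φ ε, R (x, φ + 2 * Real.pi, ε) = R (x, φ, ε)) (t : ℝ) (l : ℕ) (x : ℝ × ℝ) (ε : ℝ) :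
    X (t + 2 * Real.pi * l) x ε = X t (X (2 * Real.pi * l) x ε) ε := by
  have hR : ∀ y φ, R (y, φ + 2 * Real.pi * l, ε) = R (y, φ, ε) := fun y φ => by
    have : Function.Periodic (fun φ => R (y, φ, ε)) (2 * Real.pi) := fun φ => hper y φ ε
    simpa [mul_comm] using this.nat_mul l φ
  have := hflow.eq_flow (ε := ε) (y := fun t => X (t + 2 * Real.pi * l) x ε) (fun t => by
    have h1 := (hflow.hasDerivAt x ε (t + 2 * Real.pi * l)).comp_add_const t (2 * Real.pi * l)
    simp only [modelVec, hR] at h1 ⊢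
    exact h1) t
  simpa using this

theorem IsLeastPeriod.exists_int_mul {x : ℝ → ℝ × ℝ} {T S : ℝ} (h : IsLeastPeriod x T)
    (hS : Function.Periodic x S) : ∃ z : ℤ, S = z * T := by
  obtain ⟨hT, hper, hmin⟩ := h
  refine ⟨⌊S / T⌋, ?_⟩
  have h1 : Function.Periodic x (S - ⌊S / T⌋ * T) := hS.sub_period (hper.int_mul _)
  have h2 : 0 ≤ S - ⌊S / T⌋ * T := by
    have := Int.floor_le (S / T)
    rw [le_div_iff₀ hT] at this
    linarith
  have h3 : S - ⌊S / T⌋ * T < T := by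
    have := Int.lt_floor_add_one (S / T)
    rw [div_lt_iff₀ hT] at this
    linarith
  rcases eq_or_lt_of_le h2 with h4 | h4
  · linarith
  · exact absurd h1 (hmin _ h4 h3)

variable (hq : IsPeriodicFamily H D F hα q T) (hmod : IsLocalModel H K₀ R N δ)
  (hflow : IsModelFlow K₀ R X G) (hC : ∀ t, q hα t ∈ N)

include hq hmod hflow hC

theorem exists_int_mul_of_resonant_eq {a b : ℝ} (hab : q hα a = q hα b) :
    ∃ z : ℤ, b - a = z * T hα := by
  refine hq.1.self_of_nhds.2.2.exists_int_mul fun t => ?_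
  have h1 := resonant_add_eq_flow hq hmod hflow hC (t - a) b
  have h2 := resonant_add_eq_flow hq hmod hflow hC (t - a) a
  rw [sub_add_cancel] at h2
  rw [h2, hab, ← h1]
  congr 1
  ring

/-- A return would make `2πl` a multiple of `2πm/n`; then `m ∣ l * n`, and coprimality gives `m ∣
l`. -/
theorem flow_resonant_ne {m n l : ℕ} (hn : 0 < n) (hmn : Nat.Coprime m n)
    (hres : T hα = 2 * Real.pi * m / n) (hl : 0 < l) (hlm : l < m) (s : ℝ) :
    X (2 * Real.pi * l) (q hα s) 0 ≠ q hα s := by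
  rw [← resonant_add_eq_flow hq hmod hflow hC]
  intro h
  obtain ⟨z, hz⟩ := exists_int_mul_of_resonant_eq hq hmod hflow hC h.symm
  rw [hres, add_sub_cancel_right] at hz
  have hn0 : (n : ℝ) ≠ 0 := by exact_mod_cast hn.ne'
  have h1 : (l : ℝ) * n = z * m := by
    field_simp at hz
    linarith
  have h2 : (l : ℤ) * n = z * m := by exact_mod_cast h1
  have h3 : (m : ℤ) ∣ (l : ℤ) * n := ⟨z, by rw [h2, mul_comm]⟩
  have h4 : m ∣ l * n := by exact_mod_cast h3
  exact absurd (Nat.le_of_dvd hl (hmn.dvd_of_dvd_mul_right h4)) (not_le.2 hlm)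

omit hq hflow hC in
theorem continuous_energyRate : Continuous fun p : (ℝ × ℝ) × ℝ × ℝ => energyRate K₀ R p.1 p.2.1 p.2.2 :=
  ((hmod.smooth_K₀.continuous_fderiv (by simp)).comp continuous_fst).clm_apply
    (contDiff_hamVec_section (n := 0) (hmod.smooth_R.of_le (by norm_cast))).continuous

/-- The Mel'nikov function is the scaled energy gain along the resonant orbit. -/
theorem melnikov_eq (m : ℕ) (φ₀ : ℝ) :
    melnikov H (q hα) m φ₀ = G (2 * Real.pi * m) (q hα (-φ₀)) 0 := by
  have h1 : ∀ t, HasDerivAt (fun t => G t (q hα (-φ₀)) 0)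
      (poisson (H₀ H) (H₁ H t) (q hα (t - φ₀))) t := by
    intro t
    have h2 := hflow.integral_hasDerivAt (q hα (-φ₀)) 0 t
    rw [← resonant_add_eq_flow hq hmod hflow hC, ← sub_eq_add_neg] at h2
    rwa [hmod.poisson_eq (hC _)]
  have hqc := hq.1.self_of_nhds.1.continuous
  have h3 : Continuous fun t => poisson (H₀ H) (H₁ H t) (q hα (t - φ₀)) := by
    simp only [hmod.poisson_eq (hC _)]
    exact (continuous_energyRate hmod).comp (f := fun t => (q hα (t - φ₀), t, (0 : ℝ))) (by fun_prop)
  rw [melnikov, intervalIntegral.integral_eq_sub_of_hasDerivAt (fun t _ => h1 t)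
    (h3.intervalIntegrable _ _), hflow.integral_zero, sub_zero]

omit hflow in
-- Shifting `φ` and `φ₀` together by `2π` only moves the window of integration, whose length is a
-- period of the integrand.
theorem melnikov_periodic_two_pi {m n : ℕ} (hn : 0 < n) (hres : T hα = 2 * Real.pi * m / n) :
    Function.Periodic (melnikov H (q hα) m) (2 * Real.pi) := by
  intro φ₀
  unfold melnikov
  simp only [hmod.poisson_eq (hC _)]
  have hR : ∀ x t, energyRate K₀ R x (t + 2 * Real.pi) 0 = energyRate K₀ R x t 0 := fun x t => by
    simp only [energyRate, hmod.periodic]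
  have hRm : ∀ x t, energyRate K₀ R x (t + 2 * Real.pi * m) 0 = energyRate K₀ R x t 0 := fun x t => by
    have : Function.Periodic (fun t => energyRate K₀ R x t 0) (2 * Real.pi) := hR x
    have h := this.nat_mul m t
    simpa [mul_comm] using h
  have hqL : Function.Periodic (q hα) (2 * Real.pi * m) := by
    have := hq.1.self_of_nhds.2.2.2.1.nat_mul n
    rw [hres, mul_div_cancel₀] at this
    · exact this
    · exact_mod_cast hn.ne'
  have hper : Function.Periodic (fun t => energyRate K₀ R (q hα (t - φ₀)) t 0) (2 * Real.pi * m) := by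
    intro t
    simp only [hRm, add_sub_right_comm, hqL (t - φ₀)]
  have h1 := hper.intervalIntegral_add_eq (-(2 * Real.pi)) 0
  rw [zero_add] at h1
  rw [← h1]
  have h2 := intervalIntegral.integral_comp_sub_right (a := 0) (b := 2 * Real.pi * m)
    (fun t => energyRate K₀ R (q hα (t - φ₀)) t 0) (2 * Real.pi)
  rw [zero_sub, sub_eq_neg_add] at h2
  rw [← h2]
  congr 1
  ext t
  have h3 := hR (q hα (t - 2 * Real.pi - φ₀)) (t - 2 * Real.pi)
  rw [sub_add_cancel] at h3
  rw [← h3]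
  congr 2
  ring

/-- The pair of functions whose common zeros are, for `ε ≠ 0`, the `2πm`-periodic points. -/
noncomputable def bifurcationMap (K₀ : ℝ × ℝ → ℝ) (X : ℝ → ℝ × ℝ → ℝ → ℝ × ℝ)
    (G : ℝ → ℝ × ℝ → ℝ → ℝ) (t : ℝ) (v : ℝ × (ℝ × ℝ)) : ℝ × ℝ :=
  (dot (X t v.2 v.1 - v.2) (hamVec K₀ v.2), G t v.2 v.1)

omit hq hC in
theorem exists_hasStrictFDerivAt_bifurcationMap {t : ℝ} (ht : 0 ≤ t) (v : ℝ × (ℝ × ℝ)) :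
    ∃ S' : ℝ × (ℝ × ℝ) →L[ℝ] ℝ × ℝ, HasStrictFDerivAt (bifurcationMap K₀ X G t) S' v := by
  obtain ⟨A, hA⟩ := hflow.strict t ht v.2 v.1
  have hV : ContDiff ℝ 1 fun v : ℝ × (ℝ × ℝ) => hamVec K₀ v.2 :=
    (contDiff_hamVec (n := 1) (hmod.smooth_K₀.of_le (by norm_cast))).comp contDiff_snd
  have hV' := hV.contDiffAt.hasStrictFDerivAt (x := v) one_ne_zero
  have hV'' : HasStrictFDerivAt (fun v : ℝ × (ℝ × ℝ) => v.2) (.snd ℝ ℝ (ℝ × ℝ)) v :=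
    hasStrictFDerivAt_snd
  have h1 := hA.fst.sub hV''
  have h2 := (h1.fst.mul hV'.fst).add (h1.snd.mul hV'.snd)
  exact ⟨_, h2.prodMk hA.snd⟩

/-- At a simple zero of the Mel'nikov function the bifurcation map is nondegenerate. -/
theorem bifurcationMap_injective {G₀ : ℝ → ℝ} {K₁ : ℝ × ℝ → ℝ → ℝ → ℝ} {I₀ μ ε₁ h : ℝ}
    (hε₁ : 0 < ε₁) (hK : IsTwoDofHamiltonian F G₀ K₁ D I₀ μ)
    (hH : IsReducedHamiltonian F G₀ K₁ D I₀ μ ε₁ h H) (hND : N ⊆ D) {m n : ℕ} (hn : 0 < n)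
    (hres : T hα = 2 * Real.pi * m / n) (htwist : deriv T hα ≠ 0) {φ₀ : ℝ}
    (hsimple : deriv (melnikov H (q hα) m) φ₀ ≠ 0) {S' : ℝ × (ℝ × ℝ) →L[ℝ] ℝ × ℝ}
    (hS : HasStrictFDerivAt (bifurcationMap K₀ X G (2 * Real.pi * m)) S' (0, q hα (-φ₀)))
    (w : ℝ × ℝ) (hw : S' (0, w) = 0) : w = 0 := by
  have hn0 : (n : ℝ) ≠ 0 := by exact_mod_cast hn.ne'
  have hnT : n * T hα = 2 * Real.pi * m := by
    rw [hres]
    field_simp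
  set c := q hα (-φ₀) with hc
  set L := 2 * Real.pi * m with hL
  have h1 : HasFDerivAt (fun x => bifurcationMap K₀ X G L (0, x)) (S'.comp (.inr ℝ ℝ (ℝ × ℝ))) c :=
    hS.hasFDerivAt.comp c (hasFDerivAt_prodMk_right 0 c)
  have h1a : HasFDerivAt (fun x => dot (X L x 0 - x) (hamVec K₀ x))
      ((ContinuousLinearMap.fst ℝ ℝ ℝ).comp (S'.comp (.inr ℝ ℝ (ℝ × ℝ)))) c := h1.fst
  have h1b : HasFDerivAt (fun x => G L x 0)
      ((ContinuousLinearMap.snd ℝ ℝ ℝ).comp (S'.comp (.inr ℝ ℝ (ℝ × ℝ)))) c := h1.snd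
  have hq1 : HasDerivAt (fun t => q hα (-t)) (-hamVec K₀ c) φ₀ := by
    have h2 := (hq.1.self_of_nhds.1 (-φ₀)).2
    rw [hmod.hamVec_eq (hC _) _ (by simpa using hmod.pos), IsModelFlow.modelVec_unperturbed] at h2
    simpa [Function.comp_def] using h2.scomp φ₀ (hasDerivAt_neg φ₀)
  have hqL : ∀ t, X L (q hα t) 0 = q hα t := fun t => by
    rw [← resonant_add_eq_flow hq hmod hflow hC, add_comm, ← hnT]
    exact hq.1.self_of_nhds.2.2.2.1.nat_mul n t
  -- Along the resonant orbit the first component vanishes identically while the second is the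
  -- Mel'nikov function; this computes both derivatives in the tangent direction.
  have hfst : HasDerivAt (fun _ : ℝ => (0 : ℝ))
      (((ContinuousLinearMap.fst ℝ ℝ ℝ).comp (S'.comp (.inr ℝ ℝ (ℝ × ℝ)))) (-hamVec K₀ c)) φ₀ := by
    have h2 := h1a.comp_hasDerivAt φ₀ hq1
    refine h2.congr_of_eventuallyEq (.of_forall fun t => ?_)
    simp [hqL, dot]
  have hsnd : HasDerivAt (melnikov H (q hα) m)
      (((ContinuousLinearMap.snd ℝ ℝ ℝ).comp (S'.comp (.inr ℝ ℝ (ℝ × ℝ)))) (-hamVec K₀ c)) φ₀ := by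
    have h2 := h1b.comp_hasDerivAt φ₀ hq1
    refine h2.congr_of_eventuallyEq (.of_forall fun t => ?_)
    rw [melnikov_eq hq hmod hflow hC]
    rfl
  refine eq_zero_of_linear_forms (v := -hamVec K₀ c)
    (twist_deriv_ne_zero hq hmod hflow hC hε₁ hK hH hND hn htwist (-φ₀) (hnT.symm ▸ h1a))
    (hfst.unique (hasDerivAt_const _ _)) ?_ ?_ ?_ (b :=
      (ContinuousLinearMap.snd ℝ ℝ ℝ).comp (S'.comp (.inr ℝ ℝ (ℝ × ℝ))))
  · rw [← hsnd.deriv]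
    exact hsimple
  · simp [hw]
  · simp [hw]

end Resonance

/-! ### Breakup of the resonant torus. -/

section Breakup

variable {F : ℝ × ℝ → ℝ} {G₀ : ℝ → ℝ} {K₁ : ℝ × ℝ → ℝ → ℝ → ℝ} {D : Set (ℝ × ℝ)}
  {I₀ μ ε₁ h : ℝ} {H : ℝ × ℝ → ℝ → ℝ → ℝ} {K₀ : ℝ × ℝ → ℝ} {R : (ℝ × ℝ) × ℝ × ℝ → ℝ}
  {N : Set (ℝ × ℝ)} {δ : ℝ} {X : ℝ → ℝ × ℝ → ℝ → ℝ × ℝ} {G : ℝ → ℝ × ℝ → ℝ → ℝ}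
  {q : ℝ → ℝ → ℝ × ℝ} {T : ℝ → ℝ} {hα : ℝ} {m n : ℕ}

theorem IsModelFlow.continuous_time (hflow : IsModelFlow K₀ R X G) (t : ℝ) :
    Continuous fun v : ℝ × (ℝ × ℝ) => X t v.2 v.1 :=
  hflow.continuous.comp (f := fun v : ℝ × (ℝ × ℝ) => (t, v.2, v.1)) (by fun_prop)

theorem IsModelFlow.continuous_integral (hflow : IsModelFlow K₀ R X G) {t : ℝ} (ht : 0 ≤ t) :
    Continuous fun v : ℝ × (ℝ × ℝ) => G t v.2 v.1 :=
  continuous_iff_continuousAt.2 fun v => by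
    obtain ⟨A, hA⟩ := hflow.strict t ht v.2 v.1
    exact hA.continuousAt.snd

theorem IsModelFlow.isSolution (hflow : IsModelFlow K₀ R X G) (hmod : IsLocalModel H K₀ R N δ)
    (hND : N ⊆ D) {x : ℝ × ℝ} {ε : ℝ} (hε : |ε| < δ) (hx : ∀ t, X t x ε ∈ N) :
    IsSolution H D ε fun t => X t x ε := fun t =>
  ⟨hND (hx t), by
    rw [hmod.hamVec_eq (hx t) t hε]
    exact hflow.hasDerivAt x ε t⟩

variable (hq : IsPeriodicFamily H D F hα q T) (hmod : IsLocalModel H K₀ R N δ)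
  (hflow : IsModelFlow K₀ R X G) (hC : ∀ t, q hα t ∈ N)

include hq hmod hflow hC

theorem flow_resonant_eq (hn : 0 < n) (hres : T hα = 2 * Real.pi * m / n) (t : ℝ) :
    X (2 * Real.pi * m) (q hα t) 0 = q hα t := by
  have hn0 : (n : ℝ) ≠ 0 := by exact_mod_cast hn.ne'
  have hnT : 2 * Real.pi * m = n * T hα := by
    rw [hres]
    field_simp
  rw [← resonant_add_eq_flow hq hmod hflow hC, add_comm, hnT]
  exact hq.1.self_of_nhds.2.2.2.1.nat_mul n t

theorem continuous_melnikov : Continuous (melnikov H (q hα) m) := by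
  have h1 : melnikov H (q hα) m = fun φ₀ => G (2 * Real.pi * m) (q hα (-φ₀)) 0 :=
    funext fun φ₀ => melnikov_eq hq hmod hflow hC m φ₀
  have hqc := hq.1.self_of_nhds.1.continuous
  rw [h1]
  exact (hflow.continuous_integral (by positivity)).comp
    (f := fun φ₀ : ℝ => ((0 : ℝ), q hα (-φ₀))) (by fun_prop)

theorem exists_eq_two_mul_of_melnikov (hm : 0 < m) (hn : 0 < n) (hmn : Nat.Coprime m n)
    (hres : T hα = 2 * Real.pi * m / n) {j : ℕ}
    (hj : {φ₀ ∈ Ico (0 : ℝ) (T hα) | melnikov H (q hα) m φ₀ = 0}.encard = j)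
    (hsimple : ∀ φ₀ ∈ Ico (0 : ℝ) (T hα), melnikov H (q hα) m φ₀ = 0 →
      deriv (melnikov H (q hα) m) φ₀ ≠ 0) : ∃ k : ℕ, j = 2 * k * m := by
  have hT : m * (2 * Real.pi / n) = T hα := by
    rw [hres]
    ring
  have hn0 : (0 : ℝ) < n := by exact_mod_cast hn
  rw [← hT] at hj hsimple
  refine exists_eq_two_mul_of_simple_zeros (continuous_melnikov hq hmod hflow hC)
    (p := 2 * Real.pi / n) (by positivity) ?_ hm hj hsimple
  refine periodic_div_of_coprime hn hmn (melnikov_periodic_two_pi hq hmod hC hn hres) ?_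
  rw [← hres]
  intro φ₀
  simp only [melnikov_eq hq hmod hflow hC]
  rw [neg_add, ← sub_eq_add_neg, hq.1.self_of_nhds.2.2.2.1.sub_eq]

theorem eventually_flow_ne (hn : 0 < n) (hmn : Nat.Coprime m n)
    (hres : T hα = 2 * Real.pi * m / n) (s : ℝ) :
    ∀ᶠ v in 𝓝 ((0 : ℝ), q hα s), ∀ l : ℕ, 0 < l → l < m → X (2 * Real.pi * l) v.2 v.1 ≠ v.2 := by
  have h1 : ∀ᶠ v in 𝓝 ((0 : ℝ), q hα s), ∀ l ∈ Ioo 0 m, X (2 * Real.pi * l) v.2 v.1 ≠ v.2 := by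
    refine (eventually_all_finite (finite_Ioo 0 m)).2 fun l hl => ?_
    exact (isOpen_ne_fun (hflow.continuous_time _) continuous_snd).mem_nhds
      (flow_resonant_ne hq hmod hflow hC hn hmn hres hl.1 hl.2 s)
  filter_upwards [h1] with v hv l hl hlm using hv l ⟨hl, hlm⟩

/-- If `G` vanishes, the endpoint has the energy of the starting point, and with an orthogonal
displacement `eventually_eq_of_dot_eq_zero` makes them coincide. -/
theorem eventually_flow_eq_of_bifurcationMap (hn : 0 < n)
    (hres : T hα = 2 * Real.pi * m / n) (s : ℝ) :
    ∀ᶠ v in 𝓝 ((0 : ℝ), q hα s), bifurcationMap K₀ X G (2 * Real.pi * m) v = 0 →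
      X (2 * Real.pi * m) v.2 v.1 = v.2 := by
  have h1 := eventually_eq_of_dot_eq_zero (hmod.smooth_K₀.of_le (by norm_cast))
    (hamVec_resonant_ne_zero hq hmod hflow hC s)
  have h2 : Tendsto (fun v : ℝ × (ℝ × ℝ) => (X (2 * Real.pi * m) v.2 v.1, v.2))
      (𝓝 ((0 : ℝ), q hα s)) (𝓝 (q hα s, q hα s)) := by
    have := ((hflow.continuous_time (2 * Real.pi * m)).prodMk continuous_snd).tendsto
      ((0 : ℝ), q hα s)
    rwa [flow_resonant_eq hq hmod hflow hC hn hres] at this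
  filter_upwards [h2.eventually h1] with v hv hv0
  simp only [bifurcationMap, Prod.mk_eq_zero] at hv0
  refine hv ?_ hv0.1
  rw [hflow.energy hmod.differentiable_K₀, hv0.2, mul_zero, add_zero]

/-- The resonant torus breaks up into `j / m` periodic orbits. -/
theorem exists_breakup (hε₁ : 0 < ε₁) (hK : IsTwoDofHamiltonian F G₀ K₁ D I₀ μ)
    (hH : IsReducedHamiltonian F G₀ K₁ D I₀ μ ε₁ h H) (hND : N ⊆ D)
    (hm : 0 < m) (hn : 0 < n) (hmn : Nat.Coprime m n)
    (hres : T hα = 2 * Real.pi * m / n) (htwist : deriv T hα ≠ 0) {j : ℕ}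
    (hj : {φ₀ ∈ Ico (0 : ℝ) (T hα) | melnikov H (q hα) m φ₀ = 0}.encard = j)
    (hsimple : ∀ φ₀ ∈ Ico (0 : ℝ) (T hα), melnikov H (q hα) m φ₀ = 0 →
      deriv (melnikov H (q hα) m) φ₀ ≠ 0) :
    ∃ U : Set ExtPhase, IsOpen U ∧ torus (q hα) ⊆ U ∧
      ∀ W : Set ExtPhase, IsOpen W → torus (q hα) ⊆ W →
        ∃ ε₀ > 0, ∀ ε : ℝ, 0 < |ε| → |ε| < ε₀ →
          {O ∈ periodicOrbits H D ε m | O ⊆ U}.encard * m = j ∧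
          (∀ O ∈ periodicOrbits H D ε m, O ⊆ U → O ⊆ W) ∧
          (∀ l : ℕ, 0 < l → l < m → ∀ O ∈ periodicOrbits H D ε l, ¬ O ⊆ U) := by
  obtain ⟨hT0, hqper, -⟩ := hq.1.self_of_nhds.2.2
  have hqc := hq.1.self_of_nhds.1.continuous
  set L := 2 * Real.pi * m with hL
  have hL0 : 0 < L := by positivity
  set B := bifurcationMap K₀ X G L with hB
  set Z := {φ₀ ∈ Ico (0 : ℝ) (T hα) | melnikov H (q hα) m φ₀ = 0} with hZ
  have hZfin : Z.Finite := finite_of_encard_eq_coe hj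
  have hBq : ∀ s, B (0, q hα (-s)) = (0, melnikov H (q hα) m s) := fun s => by
    simp only [hB, bifurcationMap]
    rw [flow_resonant_eq hq hmod hflow hC hn hres, melnikov_eq hq hmod hflow hC, ← hL]
    simp [dot]
  have hbranch : ∀ φ₀ ∈ Z, ∃ z : ℝ → ℝ × ℝ, Tendsto z (𝓝 0) (𝓝 (q hα (-φ₀))) ∧
      ∀ᶠ v in 𝓝 ((0 : ℝ), q hα (-φ₀)), B v = 0 ↔ z v.1 = v.2 := by
    intro φ₀ hφ₀
    obtain ⟨S', hS'⟩ := exists_hasStrictFDerivAt_bifurcationMap hmod hflow hL0.le (0, q hα (-φ₀))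
    exact exists_zero_branch hS' (by rw [hBq, hφ₀.2]; rfl)
      (bifurcationMap_injective hq hmod hflow hC hε₁ hK hH hND hn hres htwist
        (hsimple φ₀ hφ₀.1 hφ₀.2) hS')
  choose! z hz1 hz2 using hbranch
  have hcover : ∀ s, ∃ φ₀ ∈ Ico 0 (T hα), q hα s = q hα (-φ₀) := fun s => by
    have : Function.Periodic (fun t => q hα (-t)) (T hα) := fun t => by
      simp only [neg_add, ← sub_eq_add_neg, hqper.sub_eq]
    obtain ⟨φ₀, h1, h2⟩ := this.exists_mem_Ico₀ hT0 (-s)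
    exact ⟨φ₀, h1, by simpa using h2⟩
  have hCc : IsCompact (range (q hα)) := by
    have : range (q hα) = q hα '' Icc 0 (T hα) := by
      have := hqper.image_Icc hT0 0
      rw [zero_add] at this
      exact this.symm
    rw [this]
    exact isCompact_Icc.image hqc
  have hlocal : ∀ c ∈ range (q hα), ∀ᶠ v in 𝓝 ((0 : ℝ), c),
      v.2 ∈ N ∧ (∀ l : ℕ, 0 < l → l < m → X (2 * Real.pi * l) v.2 v.1 ≠ v.2) ∧
        (B v = 0 → X L v.2 v.1 = v.2) ∧ (B v = 0 → ∃ φ₀ ∈ Z, z φ₀ v.1 = v.2) := by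
    rintro _ ⟨s, rfl⟩
    have h1 : ∀ᶠ v in 𝓝 ((0 : ℝ), q hα s), B v = 0 → ∃ φ₀ ∈ Z, z φ₀ v.1 = v.2 := by
      obtain ⟨φ₀, hφ₀, hs⟩ := hcover s
      rw [hs]
      by_cases h0 : melnikov H (q hα) m φ₀ = 0
      · filter_upwards [hz2 φ₀ ⟨hφ₀, h0⟩] with v hv hv0
        exact ⟨φ₀, ⟨hφ₀, h0⟩, hv.1 hv0⟩
      · obtain ⟨S', hS'⟩ :=
          exists_hasStrictFDerivAt_bifurcationMap hmod hflow hL0.le (0, q hα (-φ₀))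
        have h2 : B (0, q hα (-φ₀)) ≠ 0 := by
          rw [hBq]
          simpa using h0
        filter_upwards [hS'.continuousAt.eventually_ne h2] with v hv hv0
        exact absurd hv0 hv
    filter_upwards [continuous_snd.continuousAt.eventually (hmod.isOpen.mem_nhds (hC s)),
      eventually_flow_ne hq hmod hflow hC hn hmn hres s,
      eventually_flow_eq_of_bifurcationMap hq hmod hflow hC hn hres s, h1] with v a1 a2 a3 a4
    exact ⟨a1, a2, a3, a4⟩
  -- `U₀` is fixed before `W` and `ε₀`, as the order of quantifiers demands.
  obtain ⟨U₀, hU₀, hCU, hQ⟩ := exists_isOpen_of_eventually hCc hlocal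
  have htorusU : torus (q hα) ⊆ U₀ ×ˢ univ := by
    refine iUnion_subset fun φ₀ => ?_
    rintro _ ⟨t, rfl⟩
    exact ⟨hCU ⟨_, rfl⟩, mem_univ _⟩
  refine ⟨U₀ ×ˢ univ, hU₀.prod isOpen_univ, htorusU, fun W hW hWt => ?_⟩
  have hclose : ∀ᶠ ε in 𝓝 (0 : ℝ), ∀ φ₀ ∈ Z, ∀ t ∈ Icc 0 L,
      (X t (z φ₀ ε) ε, (t : AddCircle (2 * Real.pi))) ∈ W ∩ U₀ ×ˢ univ := by
    refine (eventually_all_finite hZfin).2 fun φ₀ hφ₀ => ?_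
    have h1 : ∀ᶠ v in 𝓝 ((0 : ℝ), q hα (-φ₀)), ∀ t ∈ Icc 0 L,
        (X t v.2 v.1, (t : AddCircle (2 * Real.pi))) ∈ W ∩ U₀ ×ˢ univ := by
      refine isCompact_Icc.eventually_forall_of_forall_eventually fun t _ => ?_
      have hX : Continuous fun p : (ℝ × (ℝ × ℝ)) × ℝ => X p.2 p.1.2 p.1.1 :=
        hflow.continuous.comp
          (f := fun p : (ℝ × (ℝ × ℝ)) × ℝ => (p.2, p.1.2, p.1.1)) (by fun_prop)
      have hcont : Continuous fun p : (ℝ × (ℝ × ℝ)) × ℝ =>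
          (X p.2 p.1.2 p.1.1, (p.2 : AddCircle (2 * Real.pi))) :=
        hX.prodMk ((AddCircle.continuous_mk' _).comp continuous_snd)
      refine hcont.continuousAt.eventually
        ((hW.inter (hU₀.prod isOpen_univ)).mem_nhds ?_)
      have h2 : (X t (q hα (-φ₀)) 0, (t : AddCircle (2 * Real.pi))) ∈ torus (q hα) := by
        rw [← resonant_add_eq_flow hq hmod hflow hC, ← sub_eq_add_neg]
        exact mem_iUnion.2 ⟨φ₀, t, rfl⟩
      exact ⟨hWt h2, htorusU h2⟩
    exact (tendsto_id.prodMk_nhds (hz1 φ₀ hφ₀)).eventually h1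
  have hzero : ∀ᶠ ε in 𝓝 (0 : ℝ), ∀ φ₀ ∈ Z, B (ε, z φ₀ ε) = 0 := by
    refine (eventually_all_finite hZfin).2 fun φ₀ hφ₀ => ?_
    filter_upwards [(tendsto_id.prodMk_nhds (hz1 φ₀ hφ₀)).eventually (hz2 φ₀ hφ₀)] with ε hε
    exact hε.2 rfl
  -- Two zeros differ by less than the least period, so their branches start at different points of
  -- the orbit.
  have hinj : ∀ᶠ ε in 𝓝 (0 : ℝ), ∀ φ₀ ∈ Z, ∀ φ₁ ∈ Z, z φ₀ ε = z φ₁ ε → φ₀ = φ₁ := by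
    refine (eventually_all_finite hZfin).2 fun φ₀ hφ₀ =>
      (eventually_all_finite hZfin).2 fun φ₁ hφ₁ => ?_
    by_cases h : φ₀ = φ₁
    · exact .of_forall fun _ _ => h
    have hne : q hα (-φ₀) ≠ q hα (-φ₁) := by
      intro heq
      obtain ⟨i, hi⟩ := exists_int_mul_of_resonant_eq hq hmod hflow hC heq
      have h1 : (-1 : ℝ) < i := by
        by_contra! h2
        nlinarith [hφ₀.1.1, hφ₁.1.1, hφ₀.1.2, hφ₁.1.2]
      have h2 : (i : ℝ) < 1 := by
        by_contra! h2
        nlinarith [hφ₀.1.1, hφ₁.1.1, hφ₀.1.2, hφ₁.1.2]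
      have h3 : -1 < i := by exact_mod_cast h1
      have h4 : i < 1 := by exact_mod_cast h2
      obtain rfl : i = 0 := by omega
      exact h (by simp at hi; linarith)
    filter_upwards [((hz1 φ₀ hφ₀).prodMk_nhds (hz1 φ₁ hφ₁)).eventually
      ((isOpen_ne_fun continuous_fst continuous_snd).mem_nhds hne)] with ε h1 h2
    exact absurd h2 h1
  have hδ : ∀ᶠ ε in 𝓝 (0 : ℝ), |ε| < δ :=
    continuous_abs.continuousAt.eventually_lt continuousAt_const (by simpa using hmod.pos)
  obtain ⟨ε₀, hε₀, hall⟩ := Metric.eventually_nhds_iff.1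
    (hQ.and (hclose.and (hzero.and (hinj.and hδ))))
  refine ⟨ε₀, hε₀, fun ε hεpos hεlt => ?_⟩
  obtain ⟨cQ, cclose, czero, cinj, cδ⟩ := hall (y := ε) (by simpa using hεlt)
  have hε : ε ≠ 0 := abs_pos.1 hεpos
  set P := (fun φ₀ => z φ₀ ε) '' Z with hP
  have hPret : ∀ p ∈ P, X L p ε = p := by
    rintro _ ⟨φ₀, hφ₀, rfl⟩
    have h1 := (cclose φ₀ hφ₀ 0 (left_mem_Icc.2 hL0.le)).2.1
    simp only [hflow.zero] at h1
    exact (cQ _ h1).2.2.1 (czero φ₀ hφ₀)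
  have hPper : ∀ p ∈ P, Function.Periodic (fun t => X t p ε) L := fun p hp =>
    hflow.periodic hmod.periodic (hPret p hp)
  have hPmem : ∀ p ∈ P, ∀ t : ℝ, (X t p ε, (t : AddCircle (2 * Real.pi))) ∈ W ∩ U₀ ×ˢ univ := by
    intro p hp t
    have h1 : Function.Periodic (fun t : ℝ => (X t p ε, (t : AddCircle (2 * Real.pi)))) L :=
      fun t => Prod.ext (hPper p hp t) (coe_add_two_pi_mul t m)
    obtain ⟨t', ht', heq⟩ := h1.exists_mem_Ico₀ hL0 t
    rw [heq]
    obtain ⟨φ₀, hφ₀, rfl⟩ := hp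
    exact cclose φ₀ hφ₀ t' (Ico_subset_Icc_self ht')
  -- Only here is `ε ≠ 0` needed: a return gives `ε * G = 0`, and `ε` is cancelled.
  have hPof : ∀ x ∈ U₀, X L x ε = x → x ∈ P := by
    intro x hx hret
    have h1 := hflow.energy hmod.differentiable_K₀ L x ε
    rw [hret, left_eq_add, mul_eq_zero] at h1
    have h2 : B (ε, x) = 0 := by
      simp only [hB, bifurcationMap, hret, h1.resolve_left hε]
      simp [dot]
    obtain ⟨φ₀, hφ₀, h3⟩ := (cQ x hx).2.2.2 h2
    exact ⟨φ₀, hφ₀, h3⟩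
  have hsol : ∀ {l : ℕ} {x : ℝ → ℝ × ℝ}, IsSolution H D ε x →
      Function.Periodic x (2 * Real.pi * l) → extOrbit x ⊆ U₀ ×ˢ univ →
      x 0 ∈ U₀ ∧ (∀ t, x t = X t (x 0) ε) ∧ X (2 * Real.pi * l) (x 0) ε = x 0 := by
    intro l x hx hper hU
    have h1 : ∀ t, x t ∈ U₀ := fun t => (hU ⟨t, rfl⟩).1
    have h2 := hx.eq_flow hmod hflow cδ fun t => (cQ _ (h1 t)).1
    refine ⟨h1 0, h2, ?_⟩
    rw [← h2]
    simpa using hper 0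
  have hset : {O ∈ periodicOrbits H D ε m | O ⊆ U₀ ×ˢ univ} =
      (fun p => extOrbit fun t => X t p ε) '' P := by
    ext O
    constructor
    · rintro ⟨⟨x, hx, hper, rfl⟩, hU⟩
      obtain ⟨h1, h2, h3⟩ := hsol hx hper hU
      exact ⟨x 0, hPof _ h1 h3, by simp only [← h2]⟩
    · rintro ⟨p, hp, rfl⟩
      refine ⟨⟨_, hflow.isSolution hmod hND cδ fun t => (cQ _ (hPmem p hp t).2.1).1,
        hPper p hp, rfl⟩, ?_⟩
      rintro _ ⟨t, rfl⟩
      exact (hPmem p hp t).2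
  refine ⟨?_, ?_, ?_⟩
  · rw [hset]
    refine encard_orbits_mul (e := fun t p => X t p ε) hm ?_ (fun p => hflow.zero p ε)
      (fun t p l => hflow.add_two_pi_mul hmod.periodic t l p ε) ?_ hPper ?_
    · rw [hP, InjOn.encard_image (fun a ha b hb => cinj a ha b hb), hj]
    · intro p hp l
      refine hPof _ (hPmem p hp _).2.1 ?_
      rw [← hflow.add_two_pi_mul hmod.periodic, add_comm]
      exact hPper p hp _
    · intro p hp
      have := (hPmem p hp 0).2.1
      simp only [hflow.zero] at this
      exact (cQ p this).2.1
  · intro O hO hOU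
    have hO' : O ∈ (fun p => extOrbit fun t => X t p ε) '' P := hset ▸ ⟨hO, hOU⟩
    obtain ⟨p, hp, rfl⟩ := hO'
    rintro _ ⟨t, rfl⟩
    exact (hPmem p hp t).1
  · rintro l hl hlm O ⟨x, hx, hper, rfl⟩ hU
    obtain ⟨h1, -, h3⟩ := hsol hx hper hU
    exact (cQ _ h1).2.1 l hl hlm h3

end Breakup

end Subharmonic

theorem proposition4p1
    (F : ℝ × ℝ → ℝ) (G : ℝ → ℝ) (K₁ : ℝ × ℝ → ℝ → ℝ → ℝ)
    (D : Set (ℝ × ℝ)) (hD : IsOpen D) (I₀ μ ε₁ h : ℝ) (hε₁ : 0 < ε₁)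
    (hK : Subharmonic.IsTwoDofHamiltonian F G K₁ D I₀ μ)
    (H : ℝ × ℝ → ℝ → ℝ → ℝ)
    (hH : Subharmonic.IsReducedHamiltonian F G K₁ D I₀ μ ε₁ h H)
    -- the resonant orbit `q hα`, of least period `2πm/n`, in its family of periodic orbits
    (m n : ℕ) (hm : 0 < m) (hn : 0 < n) (hmn : Nat.Coprime m n)
    (q : ℝ → ℝ → ℝ × ℝ) (T : ℝ → ℝ) (hα : ℝ)
    (hq : Subharmonic.IsPeriodicFamily H D F hα q T)
    (hres : T hα = 2 * Real.pi * m / n)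
    (htwist : deriv T hα ≠ 0)
    -- the zeros of the Mel'nikov function are simple, and `j` of them lie in `[0, 2πm/n)`
    (j : ℕ)
    (hj : {φ₀ ∈ Ico (0 : ℝ) (2 * Real.pi * m / n) |
      Subharmonic.melnikov H (q hα) m φ₀ = 0}.encard = j)
    (hsimple : ∀ φ₀ ∈ Ico (0 : ℝ) (2 * Real.pi * m / n),
      Subharmonic.melnikov H (q hα) m φ₀ = 0 →
        deriv (Subharmonic.melnikov H (q hα) m) φ₀ ≠ 0) :
    ∃ k : ℕ, j = 2 * k * m ∧
      ∃ U : Set Subharmonic.ExtPhase, IsOpen U ∧ Subharmonic.torus (q hα) ⊆ U ∧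
        ∀ W : Set Subharmonic.ExtPhase, IsOpen W → Subharmonic.torus (q hα) ⊆ W →
          ∃ ε₀ > 0, ∀ ε : ℝ, 0 < |ε| → |ε| < ε₀ →
            -- exactly `2k` orbits of period `2πm` lie in `U`
            {O ∈ Subharmonic.periodicOrbits H D ε m | O ⊆ U}.encard = ((2 * k : ℕ) : ℕ∞) ∧
            -- and they are even in the smaller neighbourhood `W`
            (∀ O ∈ Subharmonic.periodicOrbits H D ε m, O ⊆ U → O ⊆ W) ∧
            -- none of them closes up earlier
            (∀ l : ℕ, 0 < l → l < m →
              ∀ O ∈ Subharmonic.periodicOrbits H D ε l, ¬ O ⊆ U) := by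
  have hqα := hq.1.self_of_nhds
  have hCc : IsCompact (range (q hα)) := by
    rw [← hqα.2.2.2.1.image_Icc hqα.2.2.1 0]
    exact isCompact_Icc.image hqα.1.continuous
  have hCD : range (q hα) ⊆ D := range_subset_iff.2 fun t => (hqα.1 t).1
  obtain ⟨K₀, R, S, N, c, δ, hK₀, hR, hS, hN, hCN, hND, hδ, hK₀S, hRS, hRper, hHeq⟩ :=
    hH.exists_global_model hD hε₁ hK hCc hCD
  obtain ⟨X, Y, hflow⟩ := Subharmonic.exists_isModelFlow hK₀ hR hS hK₀S hRS hRper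
  have hmod : Subharmonic.IsLocalModel H K₀ R N δ := ⟨hN, hδ, hK₀, hR, hRper, hHeq⟩
  have hC : ∀ t, q hα t ∈ N := fun t => hCN ⟨t, rfl⟩
  rw [← hres] at hj hsimple
  obtain ⟨k, hk⟩ := Subharmonic.exists_eq_two_mul_of_melnikov hq hmod hflow hC hm hn hmn hres hj
    hsimple
  obtain ⟨U, hU, hUt, hbreak⟩ := Subharmonic.exists_breakup hq hmod hflow hC hε₁ hK hH hND hm hn hmn
    hres htwist hj hsimple
  refine ⟨k, hk, U, hU, hUt, fun W hW hWt => ?_⟩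
  obtain ⟨ε₀, hε₀, hall⟩ := hbreak W hW hWt
  refine ⟨ε₀, hε₀, fun ε h1 h2 => ?_⟩
  obtain ⟨hcount, hrest⟩ := hall ε h1 h2
  refine ⟨?_, hrest⟩
  have hm0 : (m : ℕ∞) ≠ 0 := by exact_mod_cast hm.ne'
  -- Cancelling `m` in `ℕ∞` requires excluding an infinite count, which the finite product `j` does.
  generalize {O ∈ Subharmonic.periodicOrbits H D ε m | O ⊆ U}.encard = a at hcount
  induction a with
  | top => rw [ENat.top_mul hm0] at hcount; exact absurd hcount (ENat.top_ne_natCast j)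
  | coe a =>
    have h3 : a * m = 2 * k * m := by rw [← hk]; exact_mod_cast hcount
    exact_mod_cast Nat.eq_of_mul_eq_mul_right hm h3
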